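/- Let $d\ge 0$ and let $(M,g)$ be a smooth connected Lorentzian manifold of dimension $D=d+2$, signature $(-,+,\dots,+)$. Suppose $(M,g)$ is a *Platonic wave*: there are a smooth nowhere vanishing vector field $\xi$ on $M$ which is null and Killing for $g$, and a smooth function $\Omega>0$ and a Lorentzian metric $\bar g$ on $M$ with $g=\Omega\,\bar g$ and $\bar\nabla\xi=0$, where $\bar\nabla$ is the Levi-Civita connection of $\bar g$. Then: 1. *Platonic waves are Kundt waves.* With $\nabla$ the Levi-Civita connection of $g$, the null vector field $\xi$ is affinely geodesic, $\nabla_\xi\xi=0$; its expansion $\theta=\nabla^\alpha\xi_\alpha$ vanishes; and for every null vector $n$ with $g(n,\xi)=1$, with transverse metric ${}^\perp\gamma_{\mu\nu}=g_{\mu\nu}-n_\mu\xi_\nu-\xi_\mu n_\nu$, the shear $\sigma_{\mu\nu}$ and the twist $\omega_{\mu\nu}$ vanish, where ${}^\perp\gamma_\mu{}^\alpha\,{}^\perp\gamma_\nu{}^\beta\nabla_\beta\xi_\alpha=\frac1d\theta\,{}^\perp\gamma_{\mu\nu}+\sigma_{\mu\nu}+\omega_{\mu\nu}$, $\sigma$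 is symmetric and $\omega$ antisymmetric (for $d=0$ the transverse space is zero and the last condition is empty). 2. *Platonic waves are degenerate Kundt waves.* Around every point of $M$ there are smooth coordinates $(u,t,x^1,\dots,x^d)$, with $\partial_u$ a positive multiple of $\xi$, in which $$g=2\,dt\left(du-\tilde U\,dt+\tilde A_i\,dx^i\right)+\tilde g_{ij}(t,x)\,dx^i dx^j,$$ $$\tilde U=u^2\,\tilde U^{(2)}(t,x)+u\,\tilde U^{(1)}(t,x)+\tilde U^{(0)}(t,x),\qquad \tilde A_i=u\,\tilde A^{(1)}_i(t,x)+\tilde A^{(0)}_i(t,x),$$ with smooth coefficients and $(\tilde g_{ij})$ symmetric positive definite. 3. More precisely, around every point there are Brinkmann coordinates, i.e. smooth coordinates $(u,t,x^i)$ with $\partial_u=\xi$ in which $\Omega$ depends only on $(t,x)$ and $$g=\Omega(t,x)\left[2\,dt\left(du+\bar A_i(t,x)\,dx^i-\bar U(t,x)\,dt\right)+\bar g_{ij}(t,x)\,dx^i dx^j\right],$$ with smooth coefficients and $(\bar g_{ij})$ symmetric positive definite. In any such Brinkmann chart, the functions $(u',t,x^i)$ with $u'=\Omega u$ are again smooth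 coordinates on the same domain, $\xi=\Omega\,\partial_{u'}$, and $g$ takes the degenerate Kundt form of item 2 (with $u'$ in place of $u$), with $\tilde g_{ij}=\Omega\,\bar g_{ij}$ and $$\tilde U^{(2)}=0,\quad \tilde U^{(1)}=\partial_t\ln\Omega,\quad \tilde U^{(0)}=\Omega\,\bar U,\quad \tilde A^{(1)}_i=-\partial_i\ln\Omega,\quad \tilde A^{(0)}_i=\Omega\,\bar A_i .$$ -/

import Mathlib

open scoped Manifold ContDiff

noncomputable section

/-- Coordinate space of dimension `D = d + 2`. In adapted coordinates, index `0` is `u`, index `1`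
is `t`, and index `i + 2` is `x^i` (`i : Fin d`). -/
abbrev Coord (d : ℕ) : Type := EuclideanSpace ℝ (Fin (d + 2))

/-- A (possibly rough) vector field on a `(d+2)`-dimensional manifold. -/
abbrev VField (d : ℕ) (M : Type*) [TopologicalSpace M] [ChartedSpace (Coord d) M] : Type _ :=
  (p : M) → TangentSpace (𝓡 (d + 2)) p

/-- The range of the coordinates `(t, x)`. -/
abbrev Screen (d : ℕ) : Type := ℝ × (Fin d → ℝ)

section Geometry

variable {d : ℕ} {M : Type*} [TopologicalSpace M] [ChartedSpace (Coord d) M]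
  [IsManifold (𝓡 (d + 2)) ∞ M]

/-- A smooth Lorentzian metric (signature `(-,+,…,+)`) on a `(d+2)`-dimensional manifold. -/
structure LorentzMetric (d : ℕ) (M : Type*) [TopologicalSpace M] [ChartedSpace (Coord d) M]
    [IsManifold (𝓡 (d + 2)) ∞ M] where
  /-- the bilinear form on each tangent space -/
  val (p : M) : TangentSpace (𝓡 (d + 2)) p →L[ℝ] TangentSpace (𝓡 (d + 2)) p →L[ℝ] ℝ
  symm (p : M) (v w : TangentSpace (𝓡 (d + 2)) p) : val p v w = val p w v
  /-- some vector is timelike and the form is positive definite on its orthogonal complement -/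
  lorentz (p : M) : ∃ τ : TangentSpace (𝓡 (d + 2)) p, val p τ τ < 0 ∧
    ∀ v : TangentSpace (𝓡 (d + 2)) p, val p τ v = 0 → v ≠ 0 → 0 < val p v v
  contMDiff : ContMDiff (𝓡 (d + 2)) ((𝓡 (d + 2)).prod 𝓘(ℝ, Coord d →L[ℝ] Coord d →L[ℝ] ℝ)) ∞
    (fun p ↦ Bundle.TotalSpace.mk' (Coord d →L[ℝ] Coord d →L[ℝ] ℝ)
      (E := fun p : M ↦ TangentSpace (𝓡 (d + 2)) p →L[ℝ] TangentSpace (𝓡 (d + 2)) p →L[ℝ] ℝ)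
      p (val p))

/-- `X` is a smooth vector field. -/
def IsSmoothField (X : VField d M) : Prop :=
  ContMDiff (𝓡 (d + 2)) ((𝓡 (d + 2)).prod 𝓘(ℝ, Coord d)) ∞
    (fun q ↦ Bundle.TotalSpace.mk' (Coord d) (E := fun p : M ↦ TangentSpace (𝓡 (d + 2)) p) q (X q))

/-- The vector field `X` is differentiable at `p`. -/
def IsDiffFieldAt (X : VField d M) (p : M) : Prop :=
  MDifferentiableAt (𝓡 (d + 2)) ((𝓡 (d + 2)).prod 𝓘(ℝ, Coord d))
    (fun q ↦ Bundle.TotalSpace.mk' (Coord d) (E := fun p : M ↦ TangentSpace (𝓡 (d + 2)) p) q (X q))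
    p

/-- An affine connection on `M`: `∇ Y p v` is the covariant derivative of `Y` along `v` at `p`. -/
abbrev AffineConnection (d : ℕ) (M : Type*) [TopologicalSpace M] [ChartedSpace (Coord d) M]
    [IsManifold (𝓡 (d + 2)) ∞ M] : Type _ :=
  CovariantDerivative (𝓡 (d + 2)) (Coord d) (TangentSpace (𝓡 (d + 2)) : M → Type _)

/-- `∇` is the Levi-Civita connection of `g`: it is torsion-free and satisfies
`Z(g(X, Y)) = g(∇_Z X, Y) + g(X, ∇_Z Y)`. -/
def IsLeviCivita (g : LorentzMetric d M) (nabla : AffineConnection d M) : Prop :=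
  nabla.torsion = 0 ∧
  ∀ (p : M) (X Y : VField d M), IsDiffFieldAt X p → IsDiffFieldAt Y p →
    ∀ v : TangentSpace (𝓡 (d + 2)) p,
      mvfderiv (𝓡 (d + 2)) (fun q ↦ g.val q (X q) (Y q)) p v =
        g.val p (nabla X p v) (Y p) + g.val p (X p) (nabla Y p v)

/-- The Killing equation `ℒ_ξ g = 0`, i.e. `ξ(g(X, Y)) = g([ξ, X], Y) + g(X, [ξ, Y])`. -/
def IsKilling (g : LorentzMetric d M) (ξ : VField d M) : Prop :=
  ∀ (p : M) (X Y : VField d M), IsDiffFieldAt X p → IsDiffFieldAt Y p →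
    mvfderiv (𝓡 (d + 2)) (fun q ↦ g.val q (X q) (Y q)) p (ξ p) =
      g.val p (VectorField.mlieBracket (𝓡 (d + 2)) ξ X p) (Y p) +
        g.val p (X p) (VectorField.mlieBracket (𝓡 (d + 2)) ξ Y p)

/-- `ξ` is null for `g`; null vector fields are nowhere vanishing. -/
def IsNullField (g : LorentzMetric d M) (ξ : VField d M) : Prop :=
  ∀ p, ξ p ≠ 0 ∧ g.val p (ξ p) (ξ p) = 0

/-- `ξ` is parallel for the Levi-Civita connection of `g`. -/
def IsParallel (g : LorentzMetric d M) (ξ : VField d M) : Prop :=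
  ∃ nabla : AffineConnection d M, IsLeviCivita g nabla ∧ ∀ p, nabla ξ p = 0

/-- `(M, g)` is a Platonic wave with null Killing vector field `ξ` and conformal factor `Ω`: the
vector field `ξ` is parallel for the conformally equivalent metric `gbar`, where
`g = Ω • gbar`. -/
structure IsPlatonicWave (g : LorentzMetric d M) (ξ : VField d M) (Ω : M → ℝ) : Prop where
  smooth : IsSmoothField ξ
  null : IsNullField g ξ
  killing : IsKilling g ξ
  factor_smooth : ContMDiff (𝓡 (d + 2)) 𝓘(ℝ) ∞ Ω
  factor_pos : ∀ p, 0 < Ω p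
  conformal : ∃ gbar : LorentzMetric d M,
    (∀ p v w, g.val p v w = Ω p * gbar.val p v w) ∧ IsParallel gbar ξ

/-! ### Optical scalars and Kundt waves -/

/-- The projection `v ↦ v - g(n, v) ξ - g(ξ, v) n` onto the space transverse to `ξ` and to a null
vector `n` with `g(n, ξ) = 1`. -/
def transverseProj (g : LorentzMetric d M) (ξ : VField d M) (p : M)
    (n v : TangentSpace (𝓡 (d + 2)) p) : TangentSpace (𝓡 (d + 2)) p :=
  v - g.val p n v • ξ p - g.val p (ξ p) v • n

/-- The transverse metric `g - n ⊗ ℓ - ℓ ⊗ n`, `ℓ = g(ξ)`. -/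
def transverseMetric (g : LorentzMetric d M) (ξ : VField d M) (p : M)
    (n v w : TangentSpace (𝓡 (d + 2)) p) : ℝ :=
  g.val p v w - g.val p n v * g.val p (ξ p) w - g.val p (ξ p) v * g.val p n w

/-- The transverse part of `∇ξ`, with components `γ_μ^α γ_ν^β ∇_β ξ_α`. -/
def transverseGrad (g : LorentzMetric d M) (nabla : AffineConnection d M) (ξ : VField d M) (p : M)
    (n v w : TangentSpace (𝓡 (d + 2)) p) : ℝ :=
  g.val p (nabla ξ p (transverseProj g ξ p n w)) (transverseProj g ξ p n v)

/-- The expansion `θ = ∇^α ξ_α`. -/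
def expansion (nabla : AffineConnection d M) (ξ : VField d M) (p : M) : ℝ :=
  LinearMap.trace ℝ (TangentSpace (𝓡 (d + 2)) p) (nabla ξ p).toLinearMap

/-- The shear tensor: trace-free symmetric part of the transverse part of `∇ξ`. -/
def shear (g : LorentzMetric d M) (nabla : AffineConnection d M) (ξ : VField d M) (p : M)
    (n v w : TangentSpace (𝓡 (d + 2)) p) : ℝ :=
  (transverseGrad g nabla ξ p n v w + transverseGrad g nabla ξ p n w v) / 2 -
    expansion nabla ξ p / d * transverseMetric g ξ p n v w

/-- The twist tensor: antisymmetric part of the transverse part of `∇ξ`. -/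
def twist (g : LorentzMetric d M) (nabla : AffineConnection d M) (ξ : VField d M) (p : M)
    (n v w : TangentSpace (𝓡 (d + 2)) p) : ℝ :=
  (transverseGrad g nabla ξ p n v w - transverseGrad g nabla ξ p n w v) / 2

/-- `ξ` is a Kundt vector field of `g`: null, (affine) geodesic, expansion-free, shear-free and
twist-free. Shear and twist are formed with any null vector `n` such that `g(n, ξ) = 1`. -/
def IsKundtField (g : LorentzMetric d M) (ξ : VField d M) : Prop :=
  IsSmoothField ξ ∧ IsNullField g ξ ∧
  ∃ nabla : AffineConnection d M, IsLeviCivita g nabla ∧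
    (∀ p, nabla ξ p (ξ p) = 0) ∧
    (∀ p, expansion nabla ξ p = 0) ∧
    (∀ p (n : TangentSpace (𝓡 (d + 2)) p), g.val p n n = 0 → g.val p n (ξ p) = 1 →
      ∀ v w, shear g nabla ξ p n v w = 0) ∧
    (∀ p (n : TangentSpace (𝓡 (d + 2)) p), g.val p n n = 0 → g.val p n (ξ p) = 1 →
      ∀ v w, twist g nabla ξ p n v w = 0)

/-! ### Line elements in coordinates -/

/-- The coordinates `(t, x)` of the point with coordinates `y = (u, t, x)`. -/
def screenPt (y : Coord d) : Screen d := (y 1, fun i ↦ y i.succ.succ)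

/-- The range of `(t, x)` in the chart `φ`. -/
def screenRegion (φ : OpenPartialHomeomorph M (Coord d)) : Set (Screen d) := screenPt '' φ.target

/-- The components `(du(v), dt(v), dx(v))` of a tangent vector in the chart `φ`. -/
def chartComp (φ : OpenPartialHomeomorph M (Coord d)) (p : M) (v : TangentSpace (𝓡 (d + 2)) p) :
    Coord d :=
  mfderiv (𝓡 (d + 2)) 𝓘(ℝ, Coord d) φ p v

/-- The quadratic form `2 dt (du - U dt + A_i dx^i) + h_ij dx^i dx^j` evaluated on the vector with
components `a`. -/
def waveForm (U : ℝ) (A : Fin d → ℝ) (h : Matrix (Fin d) (Fin d) ℝ) (a : Coord d) : ℝ :=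
  2 * a 1 * (a 0 - U * a 1 + ∑ i, A i * a i.succ.succ) +
    ∑ i, ∑ j, h i j * a i.succ.succ * a j.succ.succ

/-- `∂f/∂t`. -/
def dT (f : Screen d → ℝ) (s : Screen d) : ℝ := fderiv ℝ f s (1, 0)

/-- `∂f/∂x^i`. -/
def dX (f : Screen d → ℝ) (i : Fin d) (s : Screen d) : ℝ := fderiv ℝ f s (0, Pi.single i 1)

/-- `φ = (u, t, x)` is a Brinkmann chart of the Platonic wave `(g, ξ, Ω)`: `∂/∂u = ξ` and
`ds² = Ω(t,x) [2 dt (du + A_i(t,x) dx^i - U(t,x) dt) + h_ij(t,x) dx^i dx^j]`. Here `conf` is `Ω`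
as a function of `(t, x)`. -/
structure IsBrinkmannChart (g : LorentzMetric d M) (ξ : VField d M) (Ω : M → ℝ)
    (φ : OpenPartialHomeomorph M (Coord d)) (conf U : Screen d → ℝ) (A : Screen d → Fin d → ℝ)
    (h : Screen d → Matrix (Fin d) (Fin d) ℝ) : Prop where
  chart : φ ∈ IsManifold.maximalAtlas (𝓡 (d + 2)) ∞ M
  coord_field : ∀ p ∈ φ.source, chartComp φ p (ξ p) = EuclideanSpace.single 0 1
  factor : ∀ p ∈ φ.source, Ω p = conf (screenPt (φ p))
  smooth_factor : ContDiffOn ℝ ∞ conf (screenRegion φ)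
  smooth_pot : ContDiffOn ℝ ∞ U (screenRegion φ)
  smooth_coriolis : ∀ i, ContDiffOn ℝ ∞ (fun s ↦ A s i) (screenRegion φ)
  smooth_space : ∀ i j, ContDiffOn ℝ ∞ (fun s ↦ h s i j) (screenRegion φ)
  posDef : ∀ s ∈ screenRegion φ, (h s).PosDef
  line_element : ∀ p ∈ φ.source, ∀ v : TangentSpace (𝓡 (d + 2)) p,
    g.val p v v = conf (screenPt (φ p)) *
      waveForm (U (screenPt (φ p))) (A (screenPt (φ p))) (h (screenPt (φ p))) (chartComp φ p v)

/-- In the chart `φ = (u, t, x)` the metric has the Kundt form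
`ds² = 2 dt (du - U(u,t,x) dt + A_i(u,t,x) dx^i) + h_ij(t,x) dx^i dx^j`. -/
structure IsKundtChart (g : LorentzMetric d M) (φ : OpenPartialHomeomorph M (Coord d))
    (U : Coord d → ℝ) (A : Coord d → Fin d → ℝ)
    (h : Screen d → Matrix (Fin d) (Fin d) ℝ) : Prop where
  chart : φ ∈ IsManifold.maximalAtlas (𝓡 (d + 2)) ∞ M
  smooth_pot : ContDiffOn ℝ ∞ U φ.target
  smooth_coriolis : ∀ i, ContDiffOn ℝ ∞ (fun y ↦ A y i) φ.target
  smooth_space : ∀ i j, ContDiffOn ℝ ∞ (fun s ↦ h s i j) (screenRegion φ)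
  posDef : ∀ s ∈ screenRegion φ, (h s).PosDef
  line_element : ∀ p ∈ φ.source, ∀ v : TangentSpace (𝓡 (d + 2)) p,
    g.val p v v = waveForm (U (φ p)) (A (φ p)) (h (screenPt (φ p))) (chartComp φ p v)

/-- The degenerate Kundt form: moreover `U = u² U2(t,x) + u U1(t,x) + U0(t,x)` and
`A_i = u A1_i(t,x) + A0_i(t,x)`. -/
structure IsDegenerateKundtChart (g : LorentzMetric d M) (φ : OpenPartialHomeomorph M (Coord d))
    (U2 U1 U0 : Screen d → ℝ) (A1 A0 : Screen d → Fin d → ℝ)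
    (h : Screen d → Matrix (Fin d) (Fin d) ℝ) : Prop where
  kundt : IsKundtChart g φ
    (fun y ↦ y 0 ^ 2 * U2 (screenPt y) + y 0 * U1 (screenPt y) + U0 (screenPt y))
    (fun y i ↦ y 0 * A1 (screenPt y) i + A0 (screenPt y) i) h
  smooth_U2 : ContDiffOn ℝ ∞ U2 (screenRegion φ)
  smooth_U1 : ContDiffOn ℝ ∞ U1 (screenRegion φ)
  smooth_U0 : ContDiffOn ℝ ∞ U0 (screenRegion φ)
  smooth_A1 : ∀ i, ContDiffOn ℝ ∞ (fun s ↦ A1 s i) (screenRegion φ)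
  smooth_A0 : ∀ i, ContDiffOn ℝ ∞ (fun s ↦ A0 s i) (screenRegion φ)

/-- `(M, g)` is a degenerate Kundt wave with respect to `ξ`: `ξ` is a Kundt vector field, and
around every point there are coordinates `(u, t, x)`, with `∂/∂u` a positive multiple of `ξ`, in
which the metric has the degenerate Kundt form. -/
def IsDegenerateKundtWave (g : LorentzMetric d M) (ξ : VField d M) : Prop :=
  IsKundtField g ξ ∧
  ∀ p : M, ∃ (φ : OpenPartialHomeomorph M (Coord d)) (U2 U1 U0 : Screen d → ℝ)
    (A1 A0 : Screen d → Fin d → ℝ) (h : Screen d → Matrix (Fin d) (Fin d) ℝ),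
    p ∈ φ.source ∧ IsDegenerateKundtChart g φ U2 U1 U0 A1 A0 h ∧
    ∀ q ∈ φ.source, ∃ c : ℝ, 0 < c ∧ chartComp φ q (ξ q) = EuclideanSpace.single 0 c

end Geometry

end

open scoped Manifold ContDiff
open scoped Topology

-- Write `g = Ω ḡ`, `η = d ln Ω`, and let `n` be the `ḡ`-gradient of `ln Ω`. As `ξ` is `ḡ`-parallel,
-- vanishing torsion gives `∇̄_ξ X = [ξ, X]`, so metric compatibility says that `ξ` is Killing for
-- `ḡ` too. Comparison with the Killing equation for `g` leaves `ξ(Ω) = 0`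
-- (`mvfderiv_factor_eq_zero`).
--
-- Kundt property: the conformal change of connection (`exists_isLeviCivita_conformal`) yields `∇_v
-- ξ = ½ (η(v) ξ - ḡ(ξ, v) n)`. The transverse part vanishes because every term contains `ξ` or its
-- dual form; the trace is `½ (η(ξ) - ḡ(ξ, n)) = 0`; and `v = ξ` gives zero.
--
-- Brinkmann coordinates: `ḡ(ξ)` is closed, hence locally `dt`, and `dt(ξ) = ḡ(ξ, ξ) = 0`. Therefore
-- `ξ` can be straightened to `∂_u` with `t` kept as a coordinate (`exists_straightening`, resting
-- on the smooth flow `exists_smooth_flow`). In such coordinates `ḡ(∂_u) = dt`, and neither `Ω` nor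
-- the components of `ḡ` depend on `u`. The block `h` is positive definite because a vector
-- orthogonal to a null vector, and not a multiple of it, is spacelike.
--
-- Degenerate Kundt form: for `u' = Ω u` one has `Ω du = du' - u' d ln Ω`, which absorbs the
-- conformal factor at the cost of terms linear in `u'` (`waveForm_rescale`).

universe u

/-! ### Inverse function theorem and smooth local flows -/

/-- The inverse function theorem with an inverse that is smooth on a whole neighbourhood. -/
theorem exists_smooth_localInverse {E F : Type*} [NormedAddCommGroup E] [NormedSpace ℝ E]
    [CompleteSpace E] [NormedAddCommGroup F] [NormedSpace ℝ F] [CompleteSpace F]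
    {f : E → F} {U : Set E} (hU : IsOpen U) (hf : ContDiffOn ℝ ∞ f U) {a : E} (ha : a ∈ U)
    {f' : E ≃L[ℝ] F} (hf' : HasFDerivAt f (f' : E →L[ℝ] F) a) :
    ∃ e : OpenPartialHomeomorph E F, a ∈ e.source ∧ e.source ⊆ U ∧ (∀ x, e x = f x) ∧
      ContDiffOn ℝ ∞ e e.source ∧ ContDiffOn ℝ ∞ e.symm e.target := by
  have hfa : ContDiffAt ℝ ∞ f a := hf.contDiffAt (hU.mem_nhds ha)
  let e₀ := hfa.toOpenPartialHomeomorph f hf' (by simp)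
  have hcont : ContinuousOn (fderiv ℝ f) U := hf.continuousOn_fderiv_of_isOpen hU (by simp)
  -- Invertible operators form an open set. Shrinking to points with invertible derivative makes the
  -- inverse smooth on its whole domain, not just at the image of `a`.
  let S : Set E := {x ∈ U | fderiv ℝ f x ∈ Set.range ((↑) : (E ≃L[ℝ] F) → E →L[ℝ] F)}
  have hS : S ∈ 𝓝 a := by
    have h1 : Set.range ((↑) : (E ≃L[ℝ] F) → E →L[ℝ] F) ∈ 𝓝 (fderiv ℝ f a) := by
      rw [hf'.fderiv]; exact ContinuousLinearEquiv.nhds f'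
    filter_upwards [hU.mem_nhds ha, (hcont.continuousAt (hU.mem_nhds ha)) h1] with x h2 h3
    exact ⟨h2, h3⟩
  obtain ⟨V, hVS, hVo, haV⟩ := mem_nhds_iff.1 hS
  let e := e₀.restrOpen V hVo
  have hsrc : e.source = e₀.source ∩ V := e₀.restrOpen_source V hVo
  have hcoe : ∀ x, e x = f x := fun x => rfl
  have hsub : e.source ⊆ V := hsrc ▸ Set.inter_subset_right
  refine ⟨e, ?_, fun x hx => (hVS (hsub hx)).1, hcoe, ?_, ?_⟩
  · rw [hsrc]; exact ⟨hfa.mem_toOpenPartialHomeomorph_source hf' (by simp), haV⟩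
  · exact hf.mono fun x hx => (hVS (hsub hx)).1
  · intro y hy
    have hx := e.map_target hy
    obtain ⟨hxU, g, hg⟩ := hVS (hsub hx)
    have hc : ContDiffAt ℝ ∞ f (e.symm y) := hf.contDiffAt (hU.mem_nhds hxU)
    refine (e.contDiffAt_symm hy (f₀' := g) ?_ hc).contDiffWithinAt
    rw [hg]
    exact (hc.differentiableAt (by simp)).hasFDerivAt

/-- Pointwise evaluation of a continuous family of operators, as an operator on continuous maps. -/
noncomputable def pointwiseApplyL (K E F : Type*) [TopologicalSpace K] [CompactSpace K]
    [NormedAddCommGroup E] [NormedSpace ℝ E] [NormedAddCommGroup F] [NormedSpace ℝ F] :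
    C(K, E →L[ℝ] F) →L[ℝ] C(K, E) →L[ℝ] C(K, F) :=
  LinearMap.mkContinuous₂
    (LinearMap.mk₂ ℝ (fun (A : C(K, E →L[ℝ] F)) (η : C(K, E)) =>
        (⟨fun t => A t (η t), by fun_prop⟩ : C(K, F)))
      (fun _ _ _ => by ext; simp) (fun _ _ _ => by ext; simp)
      (fun _ _ _ => by ext; simp) (fun _ _ _ => by ext; simp)) 1
    (fun A η => by
      rw [ContinuousMap.norm_le _ (by positivity)]
      intro t
      rw [one_mul]
      exact ((A t).le_opNorm _).trans (mul_le_mul (A.norm_coe_le_norm t) (η.norm_coe_le_norm t)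
        (norm_nonneg _) (norm_nonneg A)))

/-- At each `t` the mean value inequality on the ball around `γ t` bounds the remainder by `ε ‖η‖`.
The radius `δ` can be taken uniform in `t` because `η ↦ f' ∘ η` is continuous in the sup norm. -/
theorem hasFDerivAt_postcomp {K E F : Type*} [TopologicalSpace K] [CompactSpace K]
    [NormedAddCommGroup E] [NormedSpace ℝ E] [NormedAddCommGroup F] [NormedSpace ℝ F]
    (f : C(E, F)) (f' : C(E, E →L[ℝ] F)) (hf : ∀ x, HasFDerivAt f (f' x) x) (γ : C(K, E)) :
    HasFDerivAt (fun η : C(K, E) => f.comp η) (pointwiseApplyL K E F (f'.comp γ)) γ := by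
  rw [hasFDerivAt_iff_isLittleO_nhds_zero, Asymptotics.isLittleO_iff]
  intro ε hε
  have hc : Continuous fun η : C(K, E) => f'.comp η := ContinuousMap.continuous_postcomp f'
  obtain ⟨δ, hδ, H⟩ : ∃ δ > 0, ∀ ⦃η : C(K, E)⦄, dist η γ < δ →
      dist (f'.comp η) (f'.comp γ) < ε := Metric.continuous_iff'.1 hc γ ε hε |> fun h =>
    Metric.eventually_nhds_iff.1 h
  filter_upwards [Metric.ball_mem_nhds (0 : C(K, E)) hδ] with η hη
  rw [mem_ball_zero_iff] at hη
  rw [ContinuousMap.norm_le _ (by positivity)]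
  intro t
  have hηt := η.norm_coe_le_norm t
  have key := Convex.norm_image_sub_le_of_norm_hasFDerivWithin_le' (f := f) (f' := f')
    (s := Metric.ball (γ t) δ) (C := ε) (φ := f' (γ t)) (x := γ t) (y := γ t + η t)
    (fun x _ => (hf x).hasFDerivWithinAt) (fun x hx => ?_) (convex_ball _ _)
    (Metric.mem_ball_self hδ) (by simpa [mem_ball_iff_norm] using hηt.trans_lt hη)
  · simp only [add_sub_cancel_left] at key
    exact key.trans (mul_le_mul_of_nonneg_left hηt hε.le)
  -- Translating `γ` by a constant gives a nearby curve through `x` at parameter `t`, so the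
  -- sup-norm estimate `H` controls `f' x - f' (γ t)`.
  · have h1 : dist (γ + ContinuousMap.const K (x - γ t)) γ < δ := by
      rw [dist_eq_norm, add_sub_cancel_left, ContinuousMap.norm_lt_iff _ hδ]
      intro s
      exact mem_ball_iff_norm.1 hx
    have h2 := H h1
    have h3 := (ContinuousMap.dist_apply_le_dist (f := f'.comp (γ + ContinuousMap.const K (x - γ t)))
      (g := f'.comp γ) t).trans h2.le
    simpa [dist_eq_norm] using h3

/-- The derivative is postcomposition with `f'` followed by the bounded linear `pointwiseApplyL`, so
the induction passes from `f` to `f'`. The target changes to `E →L[ℝ] F`, hence `F` is generalized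
and shares the universe of `E`. -/
theorem contDiff_postcomp_nat {K : Type*} {E : Type u} [TopologicalSpace K] [CompactSpace K]
    [NormedAddCommGroup E] [NormedSpace ℝ E] (n : ℕ) :
    ∀ {F : Type u} [NormedAddCommGroup F] [NormedSpace ℝ F] (f : C(E, F)), ContDiff ℝ n f →
      ContDiff ℝ n (fun η : C(K, E) => f.comp η) := by
  induction n with
  | zero =>
    intro F _ _ f _
    exact contDiff_zero.2 (ContinuousMap.continuous_postcomp f)
  | succ n ih =>
    intro F _ _ f hf
    obtain ⟨f', hf', hd⟩ := contDiff_succ_iff_hasFDerivAt.1 (by exact_mod_cast hf)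
    let f'' : C(E, E →L[ℝ] F) := ⟨f', hf'.continuous⟩
    rw [Nat.cast_succ, contDiff_succ_iff_hasFDerivAt]
    have h := ih f'' hf'
    exact ⟨fun γ => pointwiseApplyL K E F (f''.comp γ), by fun_prop, hasFDerivAt_postcomp f f'' hd⟩

/-- Composition with a smooth map is a smooth operation on continuous maps on a compact space. -/
theorem contDiff_postcomp {K : Type*} {E F : Type u} [TopologicalSpace K] [CompactSpace K]
    [NormedAddCommGroup E] [NormedSpace ℝ E] [NormedAddCommGroup F] [NormedSpace ℝ F]
    (f : C(E, F)) (hf : ContDiff ℝ ∞ f) : ContDiff ℝ ∞ (fun η : C(K, E) => f.comp η) :=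
  contDiff_infty.2 fun n => contDiff_postcomp_nat n f (contDiff_infty.1 hf n)

/-- Integration from `0`, as an operator on continuous maps on the unit interval. -/
noncomputable def integrateL (E : Type*) [NormedAddCommGroup E] [NormedSpace ℝ E] :
    C(unitInterval, E) →L[ℝ] C(unitInterval, E) :=
  LinearMap.mkContinuous
    { toFun := fun γ => ⟨fun t => ∫ r in (0 : ℝ)..t, Set.IccExtend zero_le_one γ r, by
        have h : Continuous (Set.IccExtend (zero_le_one (α := ℝ)) γ) := γ.continuous.Icc_extend'
        exact (intervalIntegral.continuous_primitive
          (fun a b => h.intervalIntegrable a b) 0).comp continuous_subtype_val⟩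
      map_add' := fun γ η => by
        ext t
        have h (γ : C(unitInterval, E)) : Continuous (Set.IccExtend (zero_le_one (α := ℝ)) γ) :=
          γ.continuous.Icc_extend'
        exact intervalIntegral.integral_add ((h γ).intervalIntegrable _ _)
          ((h η).intervalIntegrable _ _)
      map_smul' := fun c γ => by
        ext t
        exact intervalIntegral.integral_smul c _ } 1
    (fun γ => by
      rw [ContinuousMap.norm_le _ (by positivity)]
      intro t
      refine (intervalIntegral.norm_integral_le_of_norm_le_const (C := ‖γ‖) fun r _ =>
        γ.norm_coe_le_norm _).trans ?_
      rw [one_mul]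
      refine mul_le_of_le_one_right (norm_nonneg _) ?_
      rw [sub_zero, abs_of_nonneg t.2.1]
      exact t.2.2)

theorem hasDerivWithinAt_integral_IccExtend {E : Type*} [NormedAddCommGroup E] [NormedSpace ℝ E]
    [CompleteSpace E]
    (γ : C(unitInterval, E)) (t : unitInterval) :
    HasDerivWithinAt (fun r : ℝ => ∫ s in (0 : ℝ)..r, Set.IccExtend zero_le_one γ s) (γ t)
      (Set.Icc 0 1) t := by
  have h : Continuous (Set.IccExtend (zero_le_one (α := ℝ)) γ) := γ.continuous.Icc_extend'
  have h1 := (h.integral_hasStrictDerivAt 0 (t : ℝ)).hasDerivAt.hasDerivWithinAt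
    (s := Set.Icc (0 : ℝ) 1)
  rwa [Set.IccExtend_val] at h1

/-- Rescaling the parameter of a curve on the unit interval by a factor in the unit interval. -/
def rescaleCurve {E : Type*} [TopologicalSpace E] (τ : unitInterval) (γ : C(unitInterval, E)) :
    C(unitInterval, E) := γ.comp ⟨fun t => τ * t, by fun_prop⟩

/-- Substitution `r ↦ τ r`. It shows that a solution of the integral equation for time `s`, slowed
down by `τ`, solves the equation for time `τ s`. -/
theorem integrateL_rescaleCurve {E : Type*} [NormedAddCommGroup E] [NormedSpace ℝ E]
    (τ : unitInterval) (γ : C(unitInterval, E)) :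
    (τ : ℝ) • integrateL E (rescaleCurve τ γ) = rescaleCurve τ (integrateL E γ) := by
  ext t
  change (τ : ℝ) • (∫ r in (0 : ℝ)..t, Set.IccExtend zero_le_one (rescaleCurve τ γ) r) =
    ∫ r in (0 : ℝ)..((τ * t : unitInterval) : ℝ), Set.IccExtend zero_le_one γ r
  have h : ∀ r ∈ Set.uIcc (0 : ℝ) t, Set.IccExtend zero_le_one (rescaleCurve τ γ) r =
      Set.IccExtend zero_le_one γ (τ * r) := by
    intro r hr
    rw [Set.uIcc_of_le t.2.1] at hr
    have h1 : r ∈ Set.Icc (0 : ℝ) 1 := ⟨hr.1, hr.2.trans t.2.2⟩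
    have h2 : (τ : ℝ) * r ∈ Set.Icc (0 : ℝ) 1 := (τ * ⟨r, h1⟩ : unitInterval).2
    rw [Set.IccExtend_of_mem _ _ h1, Set.IccExtend_of_mem _ _ h2]
    rfl
  rw [intervalIntegral.integral_congr h, intervalIntegral.smul_integral_comp_mul_left]
  simp

/-- The local flow of a smooth vector field on a Banach space depends smoothly on time and on the
initial point. -/
theorem exists_smooth_flow {E : Type u} [NormedAddCommGroup E] [NormedSpace ℝ E] [CompleteSpace E]
    {f : E → E} (hf : ContDiff ℝ ∞ f) (x₀ : E) :
    ∃ (Φ : ℝ × E → E) (V : Set (ℝ × E)), IsOpen V ∧ ((0 : ℝ), x₀) ∈ V ∧ ContDiffOn ℝ ∞ Φ V ∧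
      (∀ x, (0, x) ∈ V → Φ (0, x) = x) ∧
      ∀ p ∈ V, HasDerivAt (fun s => Φ (s, p.2)) (f (Φ p)) p.1 := by
  let fc : C(E, E) := ⟨f, hf.continuous⟩
  let N : C(unitInterval, E) → C(unitInterval, E) := fun γ => fc.comp γ
  have hN : ContDiff ℝ ∞ N := contDiff_postcomp fc hf
  let cst : E →L[ℝ] C(unitInterval, E) := ContinuousLinearMap.const ℝ unitInterval
  -- The second component vanishes exactly when `γ(τ) = x + s ∫₀^τ f(γ)`, the initial value problem
  -- with time rescaled to the unit interval. At `s = 0` the derivative of `H` is triangular with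
  -- identity diagonal, so the inverse function theorem solves for `γ` smoothly in `(s, x)`.
  let H : (ℝ × E) × C(unitInterval, E) → (ℝ × E) × C(unitInterval, E) :=
    fun q => (q.1, q.2 - cst q.1.2 - q.1.1 • integrateL E (N q.2))
  have hH : ContDiff ℝ ∞ H := by fun_prop
  let a : (ℝ × E) × C(unitInterval, E) := ((0, x₀), cst x₀)
  let L : (ℝ × E) →L[ℝ] C(unitInterval, E) := -(cst ∘L ContinuousLinearMap.snd ℝ ℝ E) -
    (ContinuousLinearMap.fst ℝ ℝ E).smulRight (integrateL E (N (cst x₀)))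
  let H' : ((ℝ × E) × C(unitInterval, E)) ≃L[ℝ] ((ℝ × E) × C(unitInterval, E)) :=
    (ContinuousLinearEquiv.refl ℝ (ℝ × E)).skewProd (ContinuousLinearEquiv.refl ℝ C(unitInterval, E)) L
  have hH' : HasFDerivAt H (H' : ((ℝ × E) × C(unitInterval, E)) →L[ℝ] ((ℝ × E) × C(unitInterval, E))) a := by
    have h1 : HasFDerivAt (fun q : (ℝ × E) × C(unitInterval, E) => integrateL E (N q.2))
        (fderiv ℝ (fun q : (ℝ × E) × C(unitInterval, E) => integrateL E (N q.2)) a) a :=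
      ((((integrateL E).contDiff.comp (hN.comp contDiff_snd)).differentiable
        (by simp)) a).hasFDerivAt
    have h2 : HasFDerivAt (fun q : (ℝ × E) × C(unitInterval, E) => q.1.1)
        ((ContinuousLinearMap.fst ℝ ℝ E) ∘L ContinuousLinearMap.fst ℝ _ _) a :=
      (hasFDerivAt_fst (p := a)).fst
    have h3 : HasFDerivAt (fun q : (ℝ × E) × C(unitInterval, E) => cst q.1.2)
        (cst ∘L (ContinuousLinearMap.snd ℝ ℝ E) ∘L ContinuousLinearMap.fst ℝ _ _) a :=
      cst.hasFDerivAt.comp a (hasFDerivAt_fst (p := a)).snd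
    refine (hasFDerivAt_fst.prodMk ((hasFDerivAt_snd.sub h3).sub (h2.smul h1))).congr_fderiv ?_
    refine ContinuousLinearMap.ext fun q => Prod.ext rfl ?_
    change q.2 - cst q.1.2 - ((0 : ℝ) • _ + q.1.1 • integrateL E (N (cst x₀))) =
      q.2 + (-cst q.1.2 - q.1.1 • integrateL E (N (cst x₀)))
    rw [zero_smul]
    abel
  obtain ⟨e, hae, -, hcoe, -, hsymm⟩ :=
    exists_smooth_localInverse isOpen_univ hH.contDiffOn (Set.mem_univ a) hH'
  have hHa : H a = ((0, x₀), 0) := by simp [H, a]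
  -- the ball of injectivity
  obtain ⟨ρ, hρ, hball⟩ := Metric.isOpen_iff.1 e.open_source a hae
  let z : ℝ × E → (ℝ × E) × C(unitInterval, E) := fun p => (p, 0)
  have hz : ContDiff ℝ ∞ z := by fun_prop
  let V₀ : Set (ℝ × E) := z ⁻¹' e.target
  have hV₀ : IsOpen V₀ := e.open_target.preimage hz.continuous
  have ha0 : ((0 : ℝ), x₀) ∈ V₀ := by
    have := e.map_source hae
    rwa [hcoe, hHa] at this
  let Γ : ℝ × E → C(unitInterval, E) := fun p => (e.symm (z p)).2
  have hΓ : ContDiffOn ℝ ∞ Γ V₀ := contDiff_snd.comp_contDiffOn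
    (hsymm.comp hz.contDiffOn fun p hp => hp)
  have hsym : ∀ p ∈ V₀, e.symm (z p) = (p, Γ p) ∧
      Γ p = cst p.2 + p.1 • integrateL E (N (Γ p)) := by
    intro p hp
    have h := e.right_inv hp
    rw [hcoe] at h
    have h1 : (e.symm (z p)).1 = p := congrArg Prod.fst h
    have h2 : (e.symm (z p)).2 - cst (e.symm (z p)).1.2 -
      (e.symm (z p)).1.1 • integrateL E (N (e.symm (z p)).2) = 0 := congrArg Prod.snd h
    rw [h1] at h2
    refine ⟨Prod.ext h1 rfl, ?_⟩
    rw [sub_sub, sub_eq_zero] at h2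
    exact h2
  have hΓ0 : Γ (0, x₀) = cst x₀ := by
    rw [(hsym _ ha0).2]; simp
  obtain ⟨δ, hδ, hδV⟩ : ∃ δ > 0, ∀ p ∈ Metric.ball ((0 : ℝ), x₀) δ,
      p ∈ V₀ ∧ dist (Γ p) (cst x₀) < ρ ∧ dist p (0, x₀) < ρ := by
    have h1 : ∀ᶠ p in 𝓝 ((0 : ℝ), x₀), p ∈ V₀ := hV₀.mem_nhds ha0
    have h2 : ∀ᶠ p in 𝓝 ((0 : ℝ), x₀), dist (Γ p) (cst x₀) < ρ := by
      have := (hΓ.continuousOn.continuousAt (hV₀.mem_nhds ha0)).eventually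
        (Metric.ball_mem_nhds _ hρ)
      rw [hΓ0] at this
      exact this
    have h3 : ∀ᶠ p in 𝓝 ((0 : ℝ), x₀), dist p (0, x₀) < ρ := Metric.ball_mem_nhds _ hρ
    obtain ⟨δ, hδ, h⟩ := Metric.eventually_nhds_iff.1 (h1.and (h2.and h3))
    exact ⟨δ, hδ, fun p hp => h hp⟩
  let Φ : ℝ × E → E := fun p => Γ p 1
  have hΦ : ContDiffOn ℝ ∞ Φ V₀ := (ContinuousMap.evalCLM ℝ (1 : unitInterval)
    : C(unitInterval, E) →L[ℝ] E).contDiff.comp_contDiffOn hΓ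
  have hscale : ∀ p ∈ Metric.ball ((0 : ℝ), x₀) δ, ∀ τ : unitInterval,
      ((τ : ℝ) * p.1, p.2) ∈ Metric.ball ((0 : ℝ), x₀) δ := by
    intro p hp τ
    rw [Metric.mem_ball, Prod.dist_eq, max_lt_iff] at hp ⊢
    refine ⟨lt_of_le_of_lt ?_ hp.1, hp.2⟩
    simp only [dist_zero_right, norm_mul]
    refine mul_le_of_le_one_left (norm_nonneg _) ?_
    rw [Real.norm_of_nonneg τ.2.1]; exact τ.2.2
  -- The solution for time `τ s` and the slowed-down solution for time `s` have the same image under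
  -- `H` and lie in the ball of injectivity, hence coincide.
  have hflow : ∀ p ∈ Metric.ball ((0 : ℝ), x₀) δ, ∀ τ : unitInterval,
      Φ ((τ : ℝ) * p.1, p.2) = Γ p τ := by
    intro p hp τ
    obtain ⟨hpV, hpΓ, hpρ⟩ := hδV p hp
    obtain ⟨hqV, hqΓ, hqρ⟩ := hδV _ (hscale p hp τ)
    set q : ℝ × E := ((τ : ℝ) * p.1, p.2)
    have h1 : (q, Γ q) ∈ e.source := hball (by
      rw [Metric.mem_ball, Prod.dist_eq]; exact max_lt hqρ hqΓ)
    have h2 : (q, rescaleCurve τ (Γ p)) ∈ e.source := hball (by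
      rw [Metric.mem_ball, Prod.dist_eq]
      refine max_lt hqρ ?_
      rw [ContinuousMap.dist_lt_iff hρ]
      intro t
      exact (ContinuousMap.dist_apply_le_dist (f := Γ p) (g := cst x₀) (τ * t)).trans_lt hpΓ)
    have h3 : e (q, Γ q) = e (q, rescaleCurve τ (Γ p)) := by
      rw [hcoe, hcoe]
      have h4 : Γ q - cst q.2 - q.1 • integrateL E (N (Γ q)) = 0 := by
        rw [sub_sub, sub_eq_zero]; exact (hsym q hqV).2
      have h5 : rescaleCurve τ (Γ p) - cst q.2 -
          q.1 • integrateL E (N (rescaleCurve τ (Γ p))) = 0 := by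
        have h6 : q.1 • integrateL E (N (rescaleCurve τ (Γ p))) =
            p.1 • rescaleCurve τ (integrateL E (N (Γ p))) := by
          rw [← integrateL_rescaleCurve, smul_smul, mul_comm]
          rfl
        rw [h6]
        ext t
        have h7 := congrArg (fun γ : C(unitInterval, E) => γ (τ * t)) (hsym p hpV).2
        change Γ p (τ * t) - p.2 - p.1 • integrateL E (N (Γ p)) (τ * t) = 0
        rw [sub_sub, sub_eq_zero]
        exact h7
      change (q, _) = (q, _)
      rw [h4, h5]
    have h8 := congrArg (fun w => w.2 1) (e.injOn h1 h2 h3)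
    change Γ q 1 = Γ p (τ * 1) at h8
    rw [mul_one] at h8
    exact h8
  -- Differentiate in `τ` twice, by the chain rule and by the integral equation, and cancel the
  -- factor `p.1 ≠ 0`.
  have hder : ∀ p ∈ Metric.ball ((0 : ℝ), x₀) δ, p.1 ≠ 0 → ∀ τ : unitInterval,
      HasDerivAt (fun s => Φ (s, p.2)) (f (Φ ((τ : ℝ) * p.1, p.2))) ((τ : ℝ) * p.1) := by
    intro p hp hp0 τ
    obtain ⟨hqV, -, -⟩ := hδV _ (hscale p hp τ)
    have hd : DifferentiableAt ℝ (fun s => Φ (s, p.2)) ((τ : ℝ) * p.1) := by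
      have h1 : DifferentiableAt ℝ Φ ((τ : ℝ) * p.1, p.2) :=
        (hΦ.contDiffAt (hV₀.mem_nhds hqV)).differentiableAt (by simp)
      exact h1.comp ((τ : ℝ) * p.1) (f := fun s : ℝ => (s, p.2)) (by fun_prop)
    have h2 : HasDerivWithinAt (fun r : ℝ => Φ (r * p.1, p.2))
        (p.1 • deriv (fun s => Φ (s, p.2)) ((τ : ℝ) * p.1)) (Set.Icc 0 1) τ :=
      (HasDerivAt.scomp (τ : ℝ) (h := fun r : ℝ => r * p.1) (g₁ := fun s => Φ (s, p.2))
        hd.hasDerivAt (hasDerivAt_mul_const p.1)).hasDerivWithinAt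
    have h3 : HasDerivWithinAt (fun r : ℝ => Φ (r * p.1, p.2))
        (p.1 • f (Γ p τ)) (Set.Icc 0 1) τ := by
      have h4 := ((hasDerivWithinAt_integral_IccExtend (N (Γ p)) τ).const_smul p.1).const_add p.2
      refine h4.congr_of_mem (fun r hr => ?_) τ.2
      have h5 := hflow p hp ⟨r, hr⟩
      rw [(hsym p (hδV p hp).1).2] at h5
      exact h5
    have h6 := (uniqueDiffOn_Icc_zero_one τ τ.2).eq_deriv _ h2 h3
    rw [hflow p hp τ, ← smul_right_injective E hp0 h6]
    exact hd.hasDerivAt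
  refine ⟨Φ, Metric.ball (0, x₀) (δ / 2), Metric.isOpen_ball, Metric.mem_ball_self (by positivity),
    hΦ.mono fun p hp => (hδV p (Metric.ball_subset_ball (by linarith) hp)).1, ?_, ?_⟩
  · intro x hx
    have hx' := Metric.ball_subset_ball (by linarith : δ / 2 ≤ δ) hx
    have h1 := (hsym _ (hδV _ hx').1).2
    change Γ (0, x) 1 = x
    rw [h1]; simp [cst]
  · rintro ⟨s, x⟩ hp
    have hp' := Metric.ball_subset_ball (by linarith : δ / 2 ≤ δ) hp
    rcases eq_or_ne s 0 with rfl | hs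
    -- At `s = 0` that factor cannot be cancelled; the derivative is read off at `τ = 0` on the
    -- trajectory of time `δ / 2`.
    · have hq : (δ / 2, x) ∈ Metric.ball ((0 : ℝ), x₀) δ := by
        rw [Metric.mem_ball, Prod.dist_eq, max_lt_iff] at hp' ⊢
        refine ⟨?_, hp'.2⟩
        simp only [dist_zero_right, Real.norm_of_nonneg (by positivity : 0 ≤ δ / 2)]
        linarith
      simpa using hder _ hq (by positivity) 0
    · simpa using hder _ hp' hs 1

/-! ### Straightening a vector field together with a first integral -/

/-- A smooth function on an open set agrees near a given point with a globally smooth one. -/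
theorem exists_contDiff_eventuallyEq {E F : Type*} [NormedAddCommGroup E] [InnerProductSpace ℝ E]
    [NormedAddCommGroup F] [NormedSpace ℝ F] [FiniteDimensional ℝ E]
    {f : E → F} {U : Set E} (hU : IsOpen U) (hf : ContDiffOn ℝ ∞ f U) {a : E} (ha : a ∈ U) :
    ∃ f₁ : E → F, ContDiff ℝ ∞ f₁ ∧ f₁ =ᶠ[𝓝 a] f := by
  obtain ⟨r, hr, hrU⟩ := Metric.nhds_basis_closedBall.mem_iff.1 (hU.mem_nhds ha)
  let χ : ContDiffBump a := ⟨r / 2, r, by positivity, by linarith⟩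
  refine ⟨fun x => χ x • f x, contDiff_iff_contDiffAt.2 fun x => ?_, ?_⟩
  · by_cases hx : x ∈ U
    · exact χ.contDiff.contDiffAt.smul (hf.contDiffAt (hU.mem_nhds hx))
    · have hx' : x ∉ tsupport χ := by
        rw [χ.tsupport_eq]; exact fun h => hx (hrU h)
      refine contDiffAt_const (c := (0 : F)) |>.congr_of_eventuallyEq ?_
      filter_upwards [(isClosed_tsupport χ).isOpen_compl.mem_nhds hx'] with y hy
      rw [image_eq_zero_of_notMem_tsupport hy, zero_smul]
  · filter_upwards [χ.eventuallyEq_one] with x hx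
    rw [hx]; simp

/-- There are linear coordinates in which a given vector is the first basis vector, and a given
covector annihilating it is the second coordinate. -/
theorem exists_adapted_equiv {d : ℕ} {x₀ : Coord d} (hx₀ : x₀ ≠ 0) {α : Coord d →L[ℝ] ℝ}
    (hα : α ≠ 0) (hαx : α x₀ = 0) :
    ∃ T : Coord d ≃L[ℝ] Coord d, T x₀ = EuclideanSpace.single 0 1 ∧ ∀ v, T v 1 = α v := by
  obtain ⟨β, hβ⟩ := SeparatingDual.exists_eq_one (R := ℝ) hx₀
  obtain ⟨V₀, hV₀⟩ : ∃ v, α v ≠ 0 := by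
    by_contra! h; exact hα (ContinuousLinearMap.ext h)
  obtain ⟨V, hαV, hβV⟩ : ∃ V, α V = 1 ∧ β V = 0 :=
    ⟨(α V₀)⁻¹ • (V₀ - β V₀ • x₀), by simp [hαx, hV₀], by simp [hβ]⟩
  -- The space splits as `ℝ x₀ ⊕ ℝ V ⊕ ker (β, α)`. The new coordinates are `β`, `α` and any
  -- isomorphism of the kernel with `ℝ^d`, composed with the projection `P`.
  let q : Coord d →ₗ[ℝ] ℝ × ℝ := (β.toLinearMap).prod α.toLinearMap
  have hq : Function.Surjective q := fun ⟨a, b⟩ =>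
    ⟨a • x₀ + b • V, by simp [q, hβ, hαx, hαV, hβV]⟩
  have hrank : Module.finrank ℝ (LinearMap.ker q) = d := by
    have h := q.finrank_range_add_finrank_ker
    rw [LinearMap.range_eq_top.2 hq] at h
    simp at h
    omega
  let κ₀ : LinearMap.ker q ≃ₗ[ℝ] (Fin d → ℝ) :=
    LinearEquiv.ofFinrankEq _ _ (by rw [hrank, Module.finrank_fin_fun])
  obtain ⟨κ, hκ⟩ := κ₀.toLinearMap.exists_extend
  let P : Coord d →ₗ[ℝ] Coord d :=
    LinearMap.id - β.toLinearMap.smulRight x₀ - α.toLinearMap.smulRight V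
  let T₀ : Coord d →ₗ[ℝ] (Fin (d + 2) → ℝ) := LinearMap.pi
    (Fin.cons β.toLinearMap (Fin.cons α.toLinearMap fun k => LinearMap.proj k ∘ₗ κ ∘ₗ P))
  let T₁ : Coord d →ₗ[ℝ] Coord d := (WithLp.linearEquiv 2 ℝ (Fin (d + 2) → ℝ)).symm ∘ₗ T₀
  have h0 : ∀ v, T₁ v 0 = β v := fun v => rfl
  have h1 : ∀ v, T₁ v 1 = α v := fun v => rfl
  have h2 : ∀ v (k : Fin d), T₁ v k.succ.succ = κ (P v) k := fun v k => rfl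
  have hinj : Function.Injective T₁ := by
    rw [injective_iff_map_eq_zero]
    intro v hv
    have hb : β v = 0 := by rw [← h0, hv]; rfl
    have ha : α v = 0 := by rw [← h1, hv]; rfl
    have hvK : v ∈ LinearMap.ker q := by simp [q, ha, hb]
    have hP : P v = v := by simp [P, ha, hb]
    have h3 : κ₀ ⟨v, hvK⟩ = 0 := by
      have h4 : κ v = κ₀ ⟨v, hvK⟩ := congrArg (fun l => l ⟨v, hvK⟩) hκ
      ext k
      rw [← h4, ← hP, ← h2, hv]; rfl
    have h5 := κ₀.map_eq_zero_iff.1 h3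
    exact congrArg Subtype.val h5
  refine ⟨(LinearEquiv.ofInjectiveEndo T₁ hinj).toContinuousLinearEquiv, ?_, fun v => h1 v⟩
  change T₁ x₀ = _
  ext i
  refine Fin.cases ?_ (fun j => Fin.cases ?_ (fun k => ?_) j) i
  · rw [h0, hβ]; simp
  · change T₁ x₀ 1 = _
    rw [h1, hαx]; simp
  · rw [h2]
    have : P x₀ = 0 := by simp [P, hβ, hαx]
    rw [this]; simp

/-- Simultaneous straightening of a vector field and of a first integral. -/
theorem exists_straightening {d : ℕ} {U : Set (Coord d)} (hU : IsOpen U) {X : Coord d → Coord d}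
    (hX : ContDiffOn ℝ ∞ X U) {t : Coord d → ℝ} (ht : ContDiffOn ℝ ∞ t U)
    {y₀ : Coord d} (hy₀ : y₀ ∈ U) (hX₀ : X y₀ ≠ 0) (ht₀ : fderiv ℝ t y₀ ≠ 0)
    (hXt : ∀ y ∈ U, fderiv ℝ t y (X y) = 0) :
    ∃ e : OpenPartialHomeomorph (Coord d) (Coord d), y₀ ∈ e.source ∧ e.source ⊆ U ∧
      ContDiffOn ℝ ∞ e e.source ∧ ContDiffOn ℝ ∞ e.symm e.target ∧
      (∀ y ∈ e.source, fderiv ℝ e y (X y) = EuclideanSpace.single 0 1) ∧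
      (∀ y ∈ e.source, e y 1 = t y) ∧
      ∃ (c : Coord d) (r : ℝ), e.target = {y | ∀ i, |y i - c i| < r} := by
  obtain ⟨f, hf, hfX⟩ := exists_contDiff_eventuallyEq hU hX hy₀
  obtain ⟨U₁, hU₁, hU₁o, hyU₁⟩ := eventually_nhds_iff.1 (hfX.and (hU.mem_nhds hy₀))
  obtain ⟨Φ, V, hV, hV₀, hΦ, hΦ0, hΦd⟩ := exists_smooth_flow hf y₀
  obtain ⟨T, hT0, hT1⟩ := exists_adapted_equiv hX₀ ht₀ (hXt y₀ hy₀)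
  set e0 : Coord d := EuclideanSpace.single 0 1 with he0
  set e1 : Coord d := EuclideanSpace.single 1 1 with he1
  have e00 : e0 0 = 1 := by simp [he0]
  -- Flow for time `w 0`, starting from the affine slice through `y₀` that `T` makes transverse to
  -- `X y₀`.
  let m : Coord d → ℝ × Coord d := fun w => (w 0, y₀ + T.symm (w - w 0 • e0))
  have hm : ContDiff ℝ ∞ m := by fun_prop
  have hm0 : m 0 = (0, y₀) := by simp [m]
  let Ψ : Coord d → Coord d := fun w => Φ (m w)
  let W₀ := m ⁻¹' V
  have hW₀ : IsOpen W₀ := hV.preimage hm.continuous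
  have hΨ : ContDiffOn ℝ ∞ Ψ W₀ := hΦ.comp hm.contDiffOn fun w hw => hw
  let W := W₀ ∩ Ψ ⁻¹' U₁
  have hW : IsOpen W := hΨ.continuousOn.isOpen_inter_preimage hW₀ hU₁o
  have hΨ0 : Ψ 0 = y₀ := by
    change Φ (m 0) = y₀
    rw [hm0]; exact hΦ0 _ hV₀
  have h0W : (0 : Coord d) ∈ W := by
    refine ⟨?_, ?_⟩
    · change m 0 ∈ V; rw [hm0]; exact hV₀
    · change Ψ 0 ∈ U₁; rw [hΨ0]; exact hyU₁
  have hΨdiff : ∀ w ∈ W, DifferentiableAt ℝ Ψ w := fun w hw =>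
    (hΨ.contDiffAt (hW₀.mem_nhds hw.1)).differentiableAt (by simp)
  have hΨX : ∀ w ∈ W, fderiv ℝ Ψ w e0 = X (Ψ w) := by
    intro w hw
    have h1 : HasLineDerivAt ℝ Ψ (f (Φ (m w))) w e0 := by
      have h2 := (hΦd (m w) hw.1)
      have h3 : HasDerivAt (fun s : ℝ => Φ (w 0 + s, (m w).2)) (f (Φ (m w))) 0 := by
        refine HasDerivAt.comp_const_add (f := fun s => Φ (s, (m w).2)) (w 0) (0 : ℝ) ?_
        simpa [m] using h2
      refine h3.congr_of_eventuallyEq (Filter.Eventually.of_forall fun s => ?_)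
      change Φ (m (w + s • e0)) = _
      congr 1
      simp only [m, PiLp.add_apply, PiLp.smul_apply, e00, smul_eq_mul, mul_one, Prod.mk.injEq,
        true_and]
      congr 2
      module
    rw [← (hΨdiff w hw).lineDeriv_eq_fderiv, h1.lineDeriv]
    exact (hU₁ _ hw.2).1
  have hΨ' : HasFDerivAt Ψ (T.symm : Coord d →L[ℝ] Coord d) 0 := by
    refine (hΨdiff 0 h0W).hasFDerivAt.congr_fderiv (ContinuousLinearMap.ext fun v => ?_)
    have h1 : fderiv ℝ Ψ 0 (v - v 0 • e0) = T.symm (v - v 0 • e0) := by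
      have h2 : HasLineDerivAt ℝ Ψ (T.symm (v - v 0 • e0)) 0 (v - v 0 • e0) := by
        have h3 : HasDerivAt (fun s : ℝ => y₀ + s • T.symm (v - v 0 • e0))
            (T.symm (v - v 0 • e0)) 0 := by
          simpa using ((hasDerivAt_id (0 : ℝ)).smul_const (T.symm (v - v 0 • e0))).const_add y₀
        have h5 : Continuous fun s : ℝ => (0 : Coord d) + s • (v - v 0 • e0) := by fun_prop
        have h6 : ∀ᶠ s : ℝ in 𝓝 0, (0 : Coord d) + s • (v - v 0 • e0) ∈ W₀ :=
          (hW₀.preimage h5).mem_nhds (by simpa using h0W.1)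
        refine h3.congr_of_eventuallyEq ?_
        filter_upwards [h6] with s hs
        have h7 : m (0 + s • (v - v 0 • e0)) = (0, y₀ + s • T.symm (v - v 0 • e0)) := by
          simp [m, e00]
        change Φ (m (0 + s • (v - v 0 • e0))) = _
        change m (0 + s • (v - v 0 • e0)) ∈ V at hs
        rw [h7] at hs ⊢
        exact hΦ0 _ hs
      rw [← (hΨdiff 0 h0W).lineDeriv_eq_fderiv, h2.lineDeriv]
    have h8 : T.symm e0 = X y₀ := by rw [← hT0, T.symm_apply_apply]
    have h9 : v = (v - v 0 • e0) + v 0 • e0 := by abel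
    conv_lhs => rw [h9, map_add, h1, map_smul, hΨX 0 h0W, hΨ0, ← h8]
    conv_rhs => rw [h9]
    simp
  obtain ⟨χ, hχ0, hχW, hχΨ, -, hχs⟩ :=
    exists_smooth_localInverse hW (hΨ.mono Set.inter_subset_left) h0W hΨ'
  have hyχ : y₀ ∈ χ.target := by
    have := χ.map_source hχ0
    rwa [hχΨ, hΨ0] at this
  have hχy : χ.symm y₀ = 0 := by
    have := χ.left_inv hχ0
    rwa [hχΨ, hΨ0] at this
  have hχU : χ.target ⊆ U := fun y hy => by
    have h1 := (hU₁ _ (hχW (χ.map_target hy)).2).2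
    rw [← hχΨ, χ.right_inv hy] at h1
    exact h1
  have hχdiff : ∀ y ∈ χ.target, DifferentiableAt ℝ χ.symm y := fun y hy =>
    (hχs.contDiffAt (χ.open_target.mem_nhds hy)).differentiableAt (by simp)
  have hχcomp : ∀ y ∈ χ.target, ∀ v, fderiv ℝ χ.symm y (fderiv ℝ Ψ (χ.symm y) v) = v := by
    intro y hy v
    have h1 : (fun w => χ.symm (Ψ w)) =ᶠ[𝓝 (χ.symm y)] id := by
      filter_upwards [χ.open_source.mem_nhds (χ.map_target hy)] with w hw
      rw [← hχΨ]; exact χ.left_inv hw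
    have h2 := h1.fderiv_eq (𝕜 := ℝ)
    have hΨy : Ψ (χ.symm y) = y := by rw [← hχΨ, χ.right_inv hy]
    have h3 : fderiv ℝ (fun w => χ.symm (Ψ w)) (χ.symm y) =
        (fderiv ℝ χ.symm y) ∘L fderiv ℝ Ψ (χ.symm y) := by
      have := fderiv_comp (χ.symm y) (g := χ.symm) (f := Ψ) (by rw [hΨy]; exact hχdiff y hy)
        (hΨdiff _ (hχW (χ.map_target hy)))
      rw [hΨy] at this
      exact this
    rw [h3, fderiv_id] at h2
    exact congrArg (fun l => l v) h2
  have hχX : ∀ y ∈ χ.target, fderiv ℝ χ.symm y (X y) = e0 := by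
    intro y hy
    have h1 := hΨX _ (hχW (χ.map_target hy))
    rw [← hχΨ (χ.symm y), χ.right_inv hy] at h1
    rw [← h1]
    exact hχcomp y hy e0
  -- Overwrite the second flow-box coordinate by `t`. Since `t` is a first integral, `X` is still
  -- sent to `e0`; and the derivative at `y₀` is `T`, whose second component is already `dt`.
  let φ : Coord d → Coord d := fun y => χ.symm y + (t y - χ.symm y 1) • e1
  have htd : ∀ y ∈ χ.target, DifferentiableAt ℝ t y := fun y hy =>
    (ht.contDiffAt (hU.mem_nhds (hχU hy))).differentiableAt (by simp)
  have hφ : ContDiffOn ℝ ∞ φ χ.target := by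
    have := ht.mono hχU
    fun_prop
  have hφd : ∀ y ∈ χ.target, ∀ v, fderiv ℝ φ y v =
      fderiv ℝ χ.symm y v + (fderiv ℝ t y v - fderiv ℝ χ.symm y v 1) • e1 := by
    intro y hy v
    have h1 := (hχdiff y hy).hasFDerivAt
    have h2 : HasFDerivAt (fun y => χ.symm y 1)
        ((EuclideanSpace.proj 1 : Coord d →L[ℝ] ℝ) ∘L fderiv ℝ χ.symm y) y :=
      (EuclideanSpace.proj 1 : Coord d →L[ℝ] ℝ).hasFDerivAt.comp y h1
    have h3 : HasFDerivAt φ _ y := h1.add (((htd y hy).hasFDerivAt.sub h2).smul_const e1)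
    rw [h3.fderiv]
    rfl
  have hφX : ∀ y ∈ χ.target, fderiv ℝ φ y (X y) = e0 := by
    intro y hy
    rw [hφd y hy, hχX y hy, hXt y (hχU hy)]
    simp [he0]
  have hφ' : HasFDerivAt φ (T : Coord d →L[ℝ] Coord d) y₀ := by
    have h1 : DifferentiableAt ℝ φ y₀ :=
      (hφ.contDiffAt (χ.open_target.mem_nhds hyχ)).differentiableAt (by simp)
    refine h1.hasFDerivAt.congr_fderiv (ContinuousLinearMap.ext fun v => ?_)
    have h2 := hχcomp y₀ hyχ (T v)
    rw [hχy, hΨ'.fderiv] at h2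
    simp only [ContinuousLinearEquiv.coe_coe, T.symm_apply_apply] at h2
    rw [hφd y₀ hyχ, h2, hT1]
    simp
  obtain ⟨e, hye, heU, heφ, hes, hesymm⟩ :=
    exists_smooth_localInverse χ.open_target hφ hyχ hφ'
  have heφ' : (e : Coord d → Coord d) = φ := funext heφ
  -- restrict to a box
  let box : ℝ → Set (Coord d) := fun r => {y | ∀ i, |y i - e y₀ i| < r}
  have hbox : ∀ r, IsOpen (box r) := by
    intro r
    simp only [box, Set.ofPred_forall]
    exact isOpen_iInter_of_finite fun i => isOpen_lt (by fun_prop) continuous_const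
  obtain ⟨r, hr, hrB⟩ : ∃ r > 0, box r ⊆ e.target := by
    have h1 : e.target ∈ 𝓝 (e y₀) := e.open_target.mem_nhds (e.map_source hye)
    let L := EuclideanSpace.equiv (Fin (d + 2)) ℝ
    have h2 : L.symm ⁻¹' e.target ∈ 𝓝 (L (e y₀)) :=
      L.symm.continuous.continuousAt.preimage_mem_nhds (by simpa using h1)
    obtain ⟨r, hr, hB⟩ := Metric.mem_nhds_iff.1 h2
    refine ⟨r, hr, fun y hy => ?_⟩
    have h3 : L y ∈ Metric.ball (L (e y₀)) r := by
      rw [Metric.mem_ball, dist_pi_lt_iff hr]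
      intro i
      rw [Real.dist_eq]
      exact hy i
    simpa using hB h3
  let e' := (e.symm.restrOpen (box r) (hbox r)).symm
  have hsrc : ∀ y, y ∈ e'.source → y ∈ e.source := fun y hy => hy.1
  have htgt : e'.target = e.target ∩ box r := rfl
  have hcoe : (e' : Coord d → Coord d) = φ := heφ'
  refine ⟨e', ⟨hye, ?_⟩, fun y hy => hχU (heU (hsrc y hy)), hes.mono hsrc,
    hesymm.mono (htgt ▸ Set.inter_subset_left), fun y hy => ?_, fun y hy => ?_, e y₀, r, ?_⟩
  · change e y₀ ∈ box r
    simp [box, hr]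
  · rw [hcoe]; exact hφX y (heU (hsrc y hy))
  · rw [hcoe]; simp [φ, he1]
  · rw [htgt]; exact Set.inter_eq_right.2 hrB

/-! ### Constant fields and coordinate fields of a chart -/

section Constant

variable {E : Type*} [NormedAddCommGroup E] [NormedSpace ℝ E]

theorem contMDiffAt_constField (v y₀ : E) :
    ContMDiffAt 𝓘(ℝ, E) (𝓘(ℝ, E).prod 𝓘(ℝ, E)) ∞
      (fun y : E ↦ Bundle.TotalSpace.mk' E (E := fun y : E ↦ TangentSpace 𝓘(ℝ, E) y) y v) y₀ := by
  rw [Bundle.contMDiffAt_totalSpace]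
  exact ⟨contMDiffAt_id, by simpa using contMDiffAt_const⟩

theorem mlieBracket_constField (v w y₀ : E) :
    VectorField.mlieBracket 𝓘(ℝ, E) (fun _ => v) (fun _ => w) y₀ = 0 := by
  have h := congrFun (VectorField.mlieBracketWithin_eq_lieBracketWithin (𝕜 := ℝ) (E := E)
    (V := fun _ => v) (W := fun _ => w) (s := Set.univ)) y₀
  refine h.trans ?_
  rw [VectorField.lieBracketWithin]
  have h0 (v : E) : fderivWithin ℝ (fun _ : E => v) Set.univ y₀ = 0 := by simp
  exact (congrArg₂ (fun A B : E →L[ℝ] E => A v - B w) (h0 w) (h0 v)).trans (sub_self 0)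

end Constant

section Charts

variable {d : ℕ} {M : Type*} [TopologicalSpace M] [ChartedSpace (Coord d) M]

/-- The vector field with constant components `v` in the chart `φ`. -/
noncomputable def coordField (φ : OpenPartialHomeomorph M (Coord d)) (v : Coord d) : VField d M :=
  VectorField.mpullback (𝓡 (d + 2)) 𝓘(ℝ, Coord d) φ (fun _ => v)

/-- The function `f` expressed in the coordinates `φ`. -/
def inChart (φ : OpenPartialHomeomorph M (Coord d)) (f : M → ℝ) : Coord d → ℝ :=
  fun y => f (φ.symm y)

variable {φ : OpenPartialHomeomorph M (Coord d)}

theorem contMDiffAt_of_chart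
    (hφ : φ ∈ IsManifold.maximalAtlas (𝓡 (d + 2)) ∞ M)
    {p : M} (hp : p ∈ φ.source) :
    ContMDiffAt (𝓡 (d + 2)) 𝓘(ℝ, Coord d) ∞ φ p :=
  contMDiffAt_of_mem_maximalAtlas hφ hp

theorem mdifferentiable_of_chart
    (hφ : φ ∈ IsManifold.maximalAtlas (𝓡 (d + 2)) ∞ M) :
    φ.MDifferentiable (𝓡 (d + 2)) 𝓘(ℝ, Coord d) :=
  ⟨(contMDiffOn_of_mem_maximalAtlas hφ).mdifferentiableOn (by simp),
    (contMDiffOn_symm_of_mem_maximalAtlas hφ).mdifferentiableOn (by simp)⟩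

theorem isInvertible_mfderiv_chart [IsManifold (𝓡 (d + 2)) ∞ M]
    (hφ : φ ∈ IsManifold.maximalAtlas (𝓡 (d + 2)) ∞ M)
    {p : M} (hp : p ∈ φ.source) :
    (mfderiv (𝓡 (d + 2)) 𝓘(ℝ, Coord d) φ p).IsInvertible :=
  ⟨(mdifferentiable_of_chart hφ).mfderiv hp, rfl⟩

theorem chartComp_coordField [IsManifold (𝓡 (d + 2)) ∞ M]
    (hφ : φ ∈ IsManifold.maximalAtlas (𝓡 (d + 2)) ∞ M)
    {p : M} (hp : p ∈ φ.source) (v : Coord d) :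
    chartComp φ p (coordField φ v p) = v :=
  (isInvertible_mfderiv_chart hφ hp).self_apply_inverse v

theorem coordField_chartComp [IsManifold (𝓡 (d + 2)) ∞ M]
    (hφ : φ ∈ IsManifold.maximalAtlas (𝓡 (d + 2)) ∞ M)
    {p : M} (hp : p ∈ φ.source) (v : TangentSpace (𝓡 (d + 2)) p) :
    coordField φ (chartComp φ p v) p = v :=
  (isInvertible_mfderiv_chart hφ hp).inverse_apply_self v

theorem contMDiffAt_coordField [IsManifold (𝓡 (d + 2)) ∞ M]
    (hφ : φ ∈ IsManifold.maximalAtlas (𝓡 (d + 2)) ∞ M)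
    {p : M} (hp : p ∈ φ.source) (v : Coord d) :
    ContMDiffAt (𝓡 (d + 2)) ((𝓡 (d + 2)).prod 𝓘(ℝ, Coord d)) ∞
      (fun q ↦ Bundle.TotalSpace.mk' (Coord d) (E := fun p : M ↦ TangentSpace (𝓡 (d + 2)) p) q
        (coordField φ v q)) p := by
  exact ContMDiffAt.mpullback_vectorField_preimage
    (contMDiffAt_constField v (φ p)) (contMDiffAt_of_chart hφ hp)
    (isInvertible_mfderiv_chart hφ hp) (by simp)

theorem isDiffFieldAt_coordField [IsManifold (𝓡 (d + 2)) ∞ M]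
    (hφ : φ ∈ IsManifold.maximalAtlas (𝓡 (d + 2)) ∞ M)
    {p : M} (hp : p ∈ φ.source) (v : Coord d) :
    IsDiffFieldAt (coordField φ v) p :=
  (contMDiffAt_coordField hφ hp v).mdifferentiableAt (by simp)

/-- Brackets are natural under pullback, and constant fields commute. -/
theorem mlieBracket_coordField [IsManifold (𝓡 (d + 2)) ∞ M]
    (hφ : φ ∈ IsManifold.maximalAtlas (𝓡 (d + 2)) ∞ M)
    {p : M} (hp : p ∈ φ.source) (v w : Coord d) :
    VectorField.mlieBracket (𝓡 (d + 2)) (coordField φ v) (coordField φ w) p = 0 := by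
  have : IsManifold (𝓡 (d + 2)) (minSmoothness ℝ 2) M := by
    rw [minSmoothness_of_isRCLikeNormedField]; infer_instance
  have h (v : Coord d) := (contMDiffAt_constField v (φ p)).mdifferentiableAt (by simp)
  have h1 := VectorField.mpullback_mlieBracket (h v) (h w)
    (contMDiffAt_of_chart hφ hp) (by
      rw [minSmoothness_of_isRCLikeNormedField]; exact WithTop.coe_le_coe.2 le_top)
  refine h1.symm.trans ((congrArg
    (mfderiv (𝓡 (d + 2)) 𝓘(ℝ, Coord d) φ p).inverse (mlieBracket_constField v w (φ p))).trans ?_)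
  exact map_zero _

theorem fderiv_inChart [IsManifold (𝓡 (d + 2)) ∞ M]
    (hφ : φ ∈ IsManifold.maximalAtlas (𝓡 (d + 2)) ∞ M)
    {f : M → ℝ} {p : M} (hp : p ∈ φ.source)
    (hf : MDifferentiableAt (𝓡 (d + 2)) 𝓘(ℝ) f p) (v : Coord d) :
    fderiv ℝ (inChart φ f) (φ p) v = mvfderiv (𝓡 (d + 2)) f p (coordField φ v p) := by
  have h1 := (mdifferentiable_of_chart hφ).comp_symm_deriv (φ.map_source hp)
  rw [φ.left_inv hp] at h1
  have h2 : chartComp φ p (mfderiv 𝓘(ℝ, Coord d) (𝓡 (d + 2)) φ.symm (φ p) v) = v :=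
    congrArg (fun l => l v) h1
  have h3 := (mdifferentiable_of_chart hφ).mdifferentiableAt_symm (φ.map_source hp)
  have h4 := mvfderiv_comp_apply_of_eq (φ p) hf h3 (φ.left_inv hp) v
  have h5 : coordField φ v p = mfderiv 𝓘(ℝ, Coord d) (𝓡 (d + 2)) φ.symm (φ p) v :=
    (congrArg (fun w => coordField φ w p) h2).symm.trans (coordField_chartComp hφ hp _)
  rw [h5]
  refine Eq.trans ?_ h4
  rw [mvfderiv, mfderiv_eq_fderiv]
  rfl

theorem contDiffOn_inChart
    (hφ : φ ∈ IsManifold.maximalAtlas (𝓡 (d + 2)) ∞ M)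
    {f : M → ℝ} (hf : ContMDiffOn (𝓡 (d + 2)) 𝓘(ℝ) ∞ f φ.source) :
    ContDiffOn ℝ ∞ (inChart φ f) φ.target := by
  rw [← contMDiffOn_iff_contDiffOn]
  exact hf.comp (contMDiffOn_symm_of_mem_maximalAtlas hφ) fun y hy => φ.map_target hy

end Charts

/-! ### Conformally equivalent Lorentzian metrics -/

/-- The difference of the Levi-Civita connections of two conformally equivalent metrics, the first
of which is `B`; here `η` is the logarithmic differential of the factor, and `n` its gradient. -/
noncomputable def conformalCorrection {E : Type*} [NormedAddCommGroup E] [NormedSpace ℝ E]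
    (B : E →L[ℝ] E →L[ℝ] ℝ) (η : E →L[ℝ] ℝ) (n : E) : E →L[ℝ] E →L[ℝ] E :=
  -- The usual formula for the factor `e^{2f}` involves `df`; here `η` is the logarithmic
  -- differential of the whole factor, so `η = 2 df`.
  (1 / 2 : ℝ) • (ContinuousLinearMap.smulRightL ℝ E E η +
    η.smulRight (ContinuousLinearMap.id ℝ E) - (ContinuousLinearMap.smulRightL ℝ E E).flip n ∘L B)

theorem conformalCorrection_apply {E : Type*} [NormedAddCommGroup E] [NormedSpace ℝ E]
    (B : E →L[ℝ] E →L[ℝ] ℝ) (η : E →L[ℝ] ℝ) (n Y v : E) :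
    conformalCorrection B η n Y v = (1 / 2 : ℝ) • (η v • Y + η Y • v - B Y v • n) := by
  simp [conformalCorrection]

section Metric

variable {d : ℕ} {M : Type*} [TopologicalSpace M] [ChartedSpace (Coord d) M]
  [IsManifold (𝓡 (d + 2)) ∞ M]

namespace LorentzMetric

variable (g : LorentzMetric d M)

/-- A nonzero null vector cannot be orthogonal to the timelike `τ`. Subtracting a multiple of `ξ`
therefore makes `v` orthogonal to `τ`, without changing `g(v, v)`. -/
theorem pos_of_orthogonal_null {p : M} {ξ v : TangentSpace (𝓡 (d + 2)) p}
    (hξ : ξ ≠ 0) (hξξ : g.val p ξ ξ = 0) (hξv : g.val p ξ v = 0) (hv : ∀ c : ℝ, v ≠ c • ξ) :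
    0 < g.val p v v := by
  obtain ⟨τ, -, hpos⟩ := g.lorentz p
  have h0 : g.val p τ ξ ≠ 0 := fun h => (hpos ξ h hξ).ne' hξξ
  set c := g.val p τ v / g.val p τ ξ
  have h1 : g.val p τ (v - c • ξ) = 0 := by
    rw [map_sub, map_smul, smul_eq_mul, div_mul_cancel₀ _ h0, sub_self]
  have h2 := hpos (v - c • ξ) h1 (sub_ne_zero.2 (hv c))
  have h3 : g.val p v ξ = 0 := by rw [g.symm, hξv]
  simpa [hξξ, hξv, h3] using h2

theorem eq_zero_of_forall {p : M} {v : TangentSpace (𝓡 (d + 2)) p}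
    (h : ∀ w, g.val p v w = 0) : v = 0 := by
  obtain ⟨τ, -, hpos⟩ := g.lorentz p
  by_contra hv
  exact (hpos v (by rw [g.symm, h]) hv).ne' (h v)

/-- Every covector is represented by a vector. -/
theorem exists_represent (p : M) (η : TangentSpace (𝓡 (d + 2)) p →L[ℝ] ℝ) :
    ∃ n, ∀ v, g.val p n v = η v := by
  have : FiniteDimensional ℝ (TangentSpace (𝓡 (d + 2)) p) :=
    inferInstanceAs (FiniteDimensional ℝ (Coord d))
  let q : TangentSpace (𝓡 (d + 2)) p →ₗ[ℝ] Module.Dual ℝ (TangentSpace (𝓡 (d + 2)) p) :=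
    { toFun := fun v => (g.val p v).toLinearMap
      map_add' := fun v w => by ext; simp
      map_smul' := fun c v => by ext; simp }
  have hinj : Function.Injective q := by
    rw [injective_iff_map_eq_zero]
    exact fun v hv => g.eq_zero_of_forall fun w => congrArg (fun l => l w) hv
  have hsurj := (LinearMap.injective_iff_surjective_of_finrank_eq_finrank
    (Subspace.dual_finrank_eq (K := ℝ) (V := TangentSpace (𝓡 (d + 2)) p)).symm).1 hinj
  obtain ⟨n, hn⟩ := hsurj η.toLinearMap
  exact ⟨n, fun v => congrArg (fun l => l v) hn⟩

theorem contMDiffAt_apply {X Y : VField d M} {p : M}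
    (hX : ContMDiffAt (𝓡 (d + 2)) ((𝓡 (d + 2)).prod 𝓘(ℝ, Coord d)) ∞
      (fun q ↦ Bundle.TotalSpace.mk' (Coord d) (E := fun p : M ↦ TangentSpace (𝓡 (d + 2)) p) q
        (X q)) p)
    (hY : ContMDiffAt (𝓡 (d + 2)) ((𝓡 (d + 2)).prod 𝓘(ℝ, Coord d)) ∞
      (fun q ↦ Bundle.TotalSpace.mk' (Coord d) (E := fun p : M ↦ TangentSpace (𝓡 (d + 2)) p) q
        (Y q)) p) :
    ContMDiffAt (𝓡 (d + 2)) 𝓘(ℝ) ∞ (fun q => g.val q (X q) (Y q)) p := by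
  have : ContMDiffAt (𝓡 (d + 2)) ((𝓡 (d + 2)).prod 𝓘(ℝ)) ∞
      (fun q ↦ Bundle.TotalSpace.mk' ℝ (E := Bundle.Trivial M ℝ) q (g.val q (X q) (Y q))) p := by
    apply ContMDiffAt.clm_bundle_apply₂ (F₁ := Coord d) (F₂ := Coord d)
    · exact g.contMDiff.contMDiffAt
    · exact hX
    · exact hY
  simp only [Bundle.contMDiffAt_totalSpace] at this
  exact this.2

theorem mdifferentiableAt_apply {X Y : VField d M} {p : M} (hX : IsDiffFieldAt X p)
    (hY : IsDiffFieldAt Y p) :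
    MDifferentiableAt (𝓡 (d + 2)) 𝓘(ℝ) (fun q => g.val q (X q) (Y q)) p := by
  have : MDifferentiableAt (𝓡 (d + 2)) ((𝓡 (d + 2)).prod 𝓘(ℝ))
      (fun q ↦ Bundle.TotalSpace.mk' ℝ (E := Bundle.Trivial M ℝ) q (g.val q (X q) (Y q))) p := by
    apply MDifferentiableAt.clm_bundle_apply₂ (F₁ := Coord d) (F₂ := Coord d)
    · exact g.contMDiff.contMDiffAt.mdifferentiableAt (by simp)
    · exact hX
    · exact hY
  simp only [← mdifferentiableWithinAt_univ, mdifferentiableWithinAt_totalSpace] at this ⊢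
  exact this.2

end LorentzMetric

theorem isDiffFieldAt_extend {p : M} (v : TangentSpace (𝓡 (d + 2)) p) :
    IsDiffFieldAt (FiberBundle.extend (Coord d) v) p :=
  FiberBundle.mdifferentiableAt_extend _ _ v

theorem IsSmoothField.isDiffFieldAt {ξ : VField d M} (hξ : IsSmoothField ξ) (p : M) :
    IsDiffFieldAt ξ p :=
  hξ.contMDiffAt.mdifferentiableAt (by simp)

variable {g gbar : LorentzMetric d M} {Ω : M → ℝ} {ξ : VField d M}

theorem mvfderiv_conformal (hΩ : ContMDiff (𝓡 (d + 2)) 𝓘(ℝ) ∞ Ω)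
    (hc : ∀ p v w, g.val p v w = Ω p * gbar.val p v w) {p : M} {X Y : VField d M}
    (hX : IsDiffFieldAt X p) (hY : IsDiffFieldAt Y p) (v : TangentSpace (𝓡 (d + 2)) p) :
    mvfderiv (𝓡 (d + 2)) (fun q ↦ g.val q (X q) (Y q)) p v =
      Ω p * mvfderiv (𝓡 (d + 2)) (fun q ↦ gbar.val q (X q) (Y q)) p v +
        gbar.val p (X p) (Y p) * mvfderiv (𝓡 (d + 2)) Ω p v := by
  have h : (fun q ↦ g.val q (X q) (Y q)) = fun q => Ω q * gbar.val q (X q) (Y q) :=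
    funext fun q => hc q _ _
  rw [h, mvfderiv_fun_mul (hΩ.contMDiffAt.mdifferentiableAt (by simp))
    (gbar.mdifferentiableAt_apply hX hY)]
  simp

/-- Torsion-freeness with `∇_X ξ = 0`. Metric compatibility along `ξ` thereby becomes the Killing
equation for `gbar`. -/
theorem nabla_eq_mlieBracket {nabla : AffineConnection d M} (hLC : IsLeviCivita gbar nabla)
    (hξ : IsSmoothField ξ) (hpar : ∀ p, nabla ξ p = 0) {X : VField d M} {p : M}
    (hX : IsDiffFieldAt X p) :
    nabla X p (ξ p) = VectorField.mlieBracket (𝓡 (d + 2)) ξ X p := by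
  have h := (nabla.torsion_eq_zero_iff.1 hLC.1) (hξ.isDiffFieldAt p) hX
  rw [hpar] at h
  simpa using h

/-- The conformal factor is constant along a field which is Killing for `g` and parallel
for the conformally equivalent metric. -/
theorem mvfderiv_factor_eq_zero (hΩ : ContMDiff (𝓡 (d + 2)) 𝓘(ℝ) ∞ Ω)
    (hc : ∀ p v w, g.val p v w = Ω p * gbar.val p v w)
    {nabla : AffineConnection d M} (hLC : IsLeviCivita gbar nabla)
    (hξ : IsSmoothField ξ) (hpar : ∀ p, nabla ξ p = 0) (hK : IsKilling g ξ) (p : M) :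
    mvfderiv (𝓡 (d + 2)) Ω p (ξ p) = 0 := by
  -- Testing on a timelike vector guarantees `gbar(τ, τ) ≠ 0`; the bracket terms cancel and `gbar(τ,
  -- τ) ξ(Ω) = 0` remains.
  obtain ⟨τ, hτ, -⟩ := gbar.lorentz p
  have hX := isDiffFieldAt_extend τ
  have h1 := hK p _ _ hX hX
  rw [mvfderiv_conformal hΩ hc hX hX, hLC.2 p _ _ hX hX, nabla_eq_mlieBracket hLC hξ hpar hX,
    hc, hc] at h1
  have h2 : gbar.val p τ τ * mvfderiv (𝓡 (d + 2)) Ω p (ξ p) = 0 := by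
    rw [FiberBundle.extend_apply_self] at h1
    linarith
  exact (mul_eq_zero.1 h2).resolve_left hτ.ne

end Metric

/-! ### Optical scalars of the rescaled metric -/

section Kundt

variable {d : ℕ} {M : Type*} [TopologicalSpace M] [ChartedSpace (Coord d) M]
  [IsManifold (𝓡 (d + 2)) ∞ M] {g gbar : LorentzMetric d M} {Ω : M → ℝ} {ξ : VField d M}

/-- The Levi-Civita connection of a conformally rescaled metric. -/
theorem exists_isLeviCivita_conformal (hΩ : ContMDiff (𝓡 (d + 2)) 𝓘(ℝ) ∞ Ω) (hpos : ∀ p, 0 < Ω p)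
    (hc : ∀ p v w, g.val p v w = Ω p * gbar.val p v w)
    {nablabar : AffineConnection d M} (hLC : IsLeviCivita gbar nablabar) :
    ∃ (nabla : AffineConnection d M) (n : VField d M), IsLeviCivita g nabla ∧
      (∀ p v, gbar.val p (n p) v = (Ω p)⁻¹ * mvfderiv (𝓡 (d + 2)) Ω p v) ∧
      ∀ (Y : VField d M) (p : M) (v : TangentSpace (𝓡 (d + 2)) p), nabla Y p v =
        nablabar Y p v + (1 / 2 : ℝ) • (((Ω p)⁻¹ * mvfderiv (𝓡 (d + 2)) Ω p v) • Y p +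
          ((Ω p)⁻¹ * mvfderiv (𝓡 (d + 2)) Ω p (Y p)) • v - gbar.val p (Y p) v • n p) := by
  let η (p : M) : TangentSpace (𝓡 (d + 2)) p →L[ℝ] ℝ := (Ω p)⁻¹ • mvfderiv (𝓡 (d + 2)) Ω p
  -- A pointwise choice suffices: adding any family of bilinear maps to a connection keeps the
  -- Leibniz rule.
  choose n hn using fun p => gbar.exists_represent p (η p)
  let A (p : M) : TangentSpace (𝓡 (d + 2)) p →L[ℝ] TangentSpace (𝓡 (d + 2)) p →L[ℝ]
      TangentSpace (𝓡 (d + 2)) p :=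
    conformalCorrection (E := Coord d) (gbar.val p) (η p) (n p)
  have hA : ∀ (p : M) (Y v : TangentSpace (𝓡 (d + 2)) p), A p Y v = (1 / 2 : ℝ) •
      (η p v • Y + η p Y • v - gbar.val p Y v • n p) := fun p Y v =>
    conformalCorrection_apply (E := Coord d) (gbar.val p) (η p) (n p) Y v
  let nabla : AffineConnection d M := nablabar.addOneForm A
  have hnabla : ∀ (Y : VField d M) (p : M) (v : TangentSpace (𝓡 (d + 2)) p),
      nabla Y p v = nablabar Y p v + (1 / 2 : ℝ) •
        (η p v • Y p + η p (Y p) • v - gbar.val p (Y p) v • n p) := by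
    intro Y p v
    rw [← hA]
    rfl
  refine ⟨nabla, n, ⟨?_, fun p X Y hX hY v => ?_⟩, hn, hnabla⟩
  · rw [CovariantDerivative.torsion_eq_zero_iff]
    intro X Y p hX hY
    -- The correction is symmetric in its two arguments, so it does not contribute to the torsion.
    rw [← (nablabar.torsion_eq_zero_iff.1 hLC.1) hX hY, hnabla, hnabla, gbar.symm p (Y p) (X p)]
    module
  · rw [mvfderiv_conformal hΩ hc hX hY, hLC.2 p X Y hX hY, hnabla, hnabla, hc, hc]
    have h1 : mvfderiv (𝓡 (d + 2)) Ω p v = Ω p * η p v :=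
      (mul_inv_cancel_left₀ (hpos p).ne' _).symm
    rw [h1]
    simp only [map_add, map_sub, map_smul, add_apply, sub_apply, smul_apply, smul_eq_mul,
      gbar.symm p _ (n p), gbar.symm p v, hn]
    simp only [gbar.symm p (Y p)]
    ring

theorem IsPlatonicWave.isKundtField (hP : IsPlatonicWave g ξ Ω) : IsKundtField g ξ := by
  obtain ⟨gbar, hc, nablabar, hLC, hpar⟩ := hP.conformal
  have hΩξ := mvfderiv_factor_eq_zero hP.factor_smooth hc hLC hP.smooth hpar hP.killing
  obtain ⟨nabla, n, hLCg, hn, hnabla⟩ :=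
    exists_isLeviCivita_conformal hP.factor_smooth hP.factor_pos hc hLC
  have hnull : ∀ p, gbar.val p (ξ p) (ξ p) = 0 := fun p => by
    have := (hP.null p).2
    rw [hc] at this
    exact (mul_eq_zero.1 this).resolve_left (hP.factor_pos p).ne'
  have hξ : ∀ (p : M) (v : TangentSpace (𝓡 (d + 2)) p), nabla ξ p v =
      (1 / 2 : ℝ) • (((Ω p)⁻¹ * mvfderiv (𝓡 (d + 2)) Ω p v) • ξ p -
        gbar.val p (ξ p) v • n p) := by
    intro p v
    rw [hnabla, hpar, hΩξ]
    simp
  -- Transverse vectors are orthogonal to `ξ`: this kills the `n`-term of `∇ξ`, and then pairing the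
  -- `ξ`-term with a transverse vector gives zero.
  have hgrad : ∀ p (m : TangentSpace (𝓡 (d + 2)) p), g.val p m (ξ p) = 1 →
      ∀ v w, transverseGrad g nabla ξ p m v w = 0 := by
    intro p m hm v w
    have h1 : ∀ v, g.val p (ξ p) (transverseProj g ξ p m v) = 0 := by
      intro v
      have h2 : g.val p (ξ p) m = 1 := by rw [g.symm, hm]
      simp [transverseProj, (hP.null p).2, h2]
    have h3 : gbar.val p (ξ p) (transverseProj g ξ p m w) = 0 := by
      have := h1 w
      rw [hc] at this
      exact (mul_eq_zero.1 this).resolve_left (hP.factor_pos p).ne'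
    rw [transverseGrad, hξ, h3]
    simp [h1]
  have hexp : ∀ p, expansion nabla ξ p = 0 := by
    intro p
    have : FiniteDimensional ℝ (TangentSpace (𝓡 (d + 2)) p) :=
      inferInstanceAs (FiniteDimensional ℝ (Coord d))
    have h1 : (nabla ξ p).toLinearMap = (1 / 2 : ℝ) •
        ((((Ω p)⁻¹ • mvfderiv (𝓡 (d + 2)) Ω p).toLinearMap).smulRight (ξ p) -
          (gbar.val p (ξ p)).toLinearMap.smulRight (n p)) := by
      ext v
      exact hξ p v
    rw [expansion, h1, map_smul, map_sub, LinearMap.trace_smulRight, LinearMap.trace_smulRight]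
    have h2 : gbar.val p (ξ p) (n p) = 0 := by rw [gbar.symm, hn, hΩξ, mul_zero]
    change (1 / 2 : ℝ) • ((Ω p)⁻¹ * mvfderiv (𝓡 (d + 2)) Ω p (ξ p) - gbar.val p (ξ p) (n p)) = 0
    rw [h2, hΩξ]
    simp
  refine ⟨hP.smooth, hP.null, nabla, hLCg, fun p => ?_, hexp, fun p m _ hm v w => ?_,
    fun p m _ hm v w => ?_⟩
  · rw [hξ, hΩξ, hnull]
    simp
  · simp [shear, hgrad p m hm, hexp]
  · simp [twist, hgrad p m hm]

end Kundt

/-! ### Changes of chart and components of vector fields -/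

section ChangeOfChart

variable {d : ℕ} {M : Type*} [TopologicalSpace M] [ChartedSpace (Coord d) M]
  {φ : OpenPartialHomeomorph M (Coord d)}

theorem trans_mem_maximalAtlas [IsManifold (𝓡 (d + 2)) ∞ M]
    (hφ : φ ∈ IsManifold.maximalAtlas (𝓡 (d + 2)) ∞ M)
    {e : OpenPartialHomeomorph (Coord d) (Coord d)} (he : ContDiffOn ℝ ∞ e e.source)
    (he' : ContDiffOn ℝ ∞ e.symm e.target) :
    φ.trans e ∈ IsManifold.maximalAtlas (𝓡 (d + 2)) ∞ M := by
  apply OpenPartialHomeomorph.mem_maximalAtlas_of_contMDiffOn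
  · refine (contMDiffOn_iff_contDiffOn.2 he).comp
      ((contMDiffOn_of_mem_maximalAtlas hφ).mono fun p hp => ?_) fun p hp => ?_
    · simp only [mfld_simps] at hp
      exact hp.1
    · simp only [mfld_simps] at hp
      exact hp.2
  · refine (contMDiffOn_symm_of_mem_maximalAtlas hφ).comp
      ((contMDiffOn_iff_contDiffOn.2 he').mono fun p hp => ?_) fun p hp => ?_
    · simp only [mfld_simps] at hp
      exact hp.1
    · simp only [mfld_simps] at hp
      exact hp.2

theorem chartComp_trans [IsManifold (𝓡 (d + 2)) ∞ M]
    (hφ : φ ∈ IsManifold.maximalAtlas (𝓡 (d + 2)) ∞ M)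
    {e : OpenPartialHomeomorph (Coord d) (Coord d)} {p : M} (hp : p ∈ φ.source)
    (he : DifferentiableAt ℝ e (φ p)) (v : TangentSpace (𝓡 (d + 2)) p) :
    chartComp (φ.trans e) p v = fderiv ℝ e (φ p) (chartComp φ p v) := by
  have h1 : MDifferentiableAt (𝓡 (d + 2)) 𝓘(ℝ, Coord d) φ p :=
    (mdifferentiable_of_chart hφ).mdifferentiableAt hp
  have h2 := mfderiv_comp_apply p he.mdifferentiableAt h1 v
  rw [mfderiv_eq_fderiv] at h2
  exact h2

theorem isInvertible_mfderiv_chart_symm [IsManifold (𝓡 (d + 2)) ∞ M]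
    (hφ : φ ∈ IsManifold.maximalAtlas (𝓡 (d + 2)) ∞ M)
    {y : Coord d} (hy : y ∈ φ.target) :
    (mfderiv 𝓘(ℝ, Coord d) (𝓡 (d + 2)) φ.symm y).IsInvertible :=
  ⟨(mdifferentiable_of_chart hφ).symm.mfderiv hy, rfl⟩

/-- The components of a smooth vector field are smooth functions of the coordinates. -/
theorem exists_chartComp_eq [IsManifold (𝓡 (d + 2)) ∞ M]
    (hφ : φ ∈ IsManifold.maximalAtlas (𝓡 (d + 2)) ∞ M) {ξ : VField d M} (hξ : IsSmoothField ξ) :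
    ∃ X : Coord d → Coord d, ContDiffOn ℝ ∞ X φ.target ∧
      ∀ y ∈ φ.target, chartComp φ (φ.symm y) (ξ (φ.symm y)) = X y := by
  refine ⟨VectorField.mpullback 𝓘(ℝ, Coord d) (𝓡 (d + 2)) φ.symm ξ, fun y hy => ?_,
    fun y hy => ?_⟩
  · have h1 := ContMDiffAt.mpullback_vectorField_preimage (m := ∞) (n := ∞) (f := φ.symm)
      (x₀ := y) hξ.contMDiffAt ((contMDiffOn_symm_of_mem_maximalAtlas hφ).contMDiffAt
      (φ.open_target.mem_nhds hy)) (isInvertible_mfderiv_chart_symm hφ hy) (by simp)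
    rw [Bundle.contMDiffAt_totalSpace] at h1
    have h2 := h1.2
    simp only [mfld_simps] at h2
    exact (contMDiffAt_iff_contDiffAt.1 h2).contDiffWithinAt
  · have h1 := (mdifferentiable_of_chart hφ).comp_symm_deriv hy
    have h2 := (isInvertible_mfderiv_chart_symm hφ hy).self_apply_inverse (ξ (φ.symm y))
    have h3 := congrArg (fun l => l ((mfderiv 𝓘(ℝ, Coord d) (𝓡 (d + 2)) φ.symm y).inverse
      (ξ (φ.symm y)))) h1
    exact (congrArg (chartComp φ (φ.symm y)) h2).symm.trans h3

end ChangeOfChart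

/-! ### The closed dual form and adapted coordinates -/

section Adapted

variable {d : ℕ} {M : Type*} [TopologicalSpace M] [ChartedSpace (Coord d) M]
  [IsManifold (𝓡 (d + 2)) ∞ M] {φ : OpenPartialHomeomorph M (Coord d)} {gbar : LorentzMetric d M}
  {ξ : VField d M}

/-- The one-form metrically dual to `ξ` in the coordinates `φ`. -/
noncomputable def dualForm (φ : OpenPartialHomeomorph M (Coord d)) (gbar : LorentzMetric d M) (ξ : VField d M)
    (y : Coord d) : Coord d →L[ℝ] ℝ :=
  (gbar.val (φ.symm y) (ξ (φ.symm y))).comp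
    (mfderiv (𝓡 (d + 2)) 𝓘(ℝ, Coord d) φ (φ.symm y)).inverse

theorem dualForm_apply (y v : Coord d) :
    dualForm φ gbar ξ y v = inChart φ (fun q => gbar.val q (ξ q) (coordField φ v q)) y := rfl

theorem dualForm_chartComp (hφ : φ ∈ IsManifold.maximalAtlas (𝓡 (d + 2)) ∞ M) {p : M}
    (hp : p ∈ φ.source) (v : TangentSpace (𝓡 (d + 2)) p) :
    dualForm φ gbar ξ (φ p) (chartComp φ p v) = gbar.val p (ξ p) v := by
  rw [dualForm_apply, inChart, φ.left_inv hp, coordField_chartComp hφ hp]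

theorem contDiffOn_dualForm (hφ : φ ∈ IsManifold.maximalAtlas (𝓡 (d + 2)) ∞ M)
    (hξ : IsSmoothField ξ) : ContDiffOn ℝ ∞ (dualForm φ gbar ξ) φ.target := by
  rw [contDiffOn_clm_apply]
  intro v
  exact contDiffOn_inChart hφ fun p hp =>
    (gbar.contMDiffAt_apply hξ.contMDiffAt (contMDiffAt_coordField hφ hp v)).contMDiffWithinAt

/-- The one-form dual to a parallel vector field is closed. -/
theorem fderiv_dualForm_comm (hφ : φ ∈ IsManifold.maximalAtlas (𝓡 (d + 2)) ∞ M)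
    (hξ : IsSmoothField ξ) {nabla : AffineConnection d M} (hLC : IsLeviCivita gbar nabla)
    (hpar : ∀ p, nabla ξ p = 0) {y : Coord d} (hy : y ∈ φ.target) (v w : Coord d) :
    fderiv ℝ (dualForm φ gbar ξ) y v w = fderiv ℝ (dualForm φ gbar ξ) y w v := by
  have hd : DifferentiableAt ℝ (dualForm φ gbar ξ) y :=
    ((contDiffOn_dualForm hφ hξ).contDiffAt (φ.open_target.mem_nhds hy)).differentiableAt (by simp)
  obtain ⟨p, hp, rfl⟩ : ∃ p ∈ φ.source, φ p = y := ⟨_, φ.map_target hy, φ.right_inv hy⟩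
  -- As `ξ` is parallel, only the derivative of the coordinate field survives. The result is
  -- symmetric in `v`, `w` because coordinate fields commute and the torsion vanishes.
  have key : ∀ v w : Coord d, fderiv ℝ (dualForm φ gbar ξ) (φ p) v w =
      gbar.val p (ξ p) (nabla (coordField φ w) p (coordField φ v p)) := by
    intro v w
    have h1 : fderiv ℝ (fun y => dualForm φ gbar ξ y w) (φ p) v =
        fderiv ℝ (dualForm φ gbar ξ) (φ p) v w := by
      rw [fderiv_clm_apply hd (differentiableAt_const w)]
      simp
    rw [← h1]
    have hw := isDiffFieldAt_coordField hφ hp w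
    refine (fderiv_inChart hφ hp (gbar.mdifferentiableAt_apply (hξ.isDiffFieldAt p) hw) v).trans ?_
    rw [hLC.2 p ξ _ (hξ.isDiffFieldAt p) hw, hpar]
    simp
  rw [key, key]
  have h := (nabla.torsion_eq_zero_iff.1 hLC.1) (isDiffFieldAt_coordField hφ hp v)
    (isDiffFieldAt_coordField hφ hp w)
  rw [mlieBracket_coordField hφ hp, sub_eq_zero] at h
  rw [h]

/-- Coordinates `(u, t, x)` with `∂/∂u = ξ` and `dt = gbar(ξ)`. -/
theorem exists_adapted_chart (hξ : IsSmoothField ξ) (hnull : IsNullField gbar ξ)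
    {nabla : AffineConnection d M} (hLC : IsLeviCivita gbar nabla) (hpar : ∀ p, nabla ξ p = 0)
    (p : M) : ∃ φ ∈ IsManifold.maximalAtlas (𝓡 (d + 2)) ∞ M, p ∈ φ.source ∧
      (∀ q ∈ φ.source, chartComp φ q (ξ q) = EuclideanSpace.single 0 1) ∧
      (∀ q ∈ φ.source, ∀ v, (chartComp φ q v) 1 = gbar.val q (ξ q) v) ∧
      ∃ (c : Coord d) (r : ℝ), φ.target = {y | ∀ i, |y i - c i| < r} := by
  set ψ := chartAt (Coord d) p
  have hψ : ψ ∈ IsManifold.maximalAtlas (𝓡 (d + 2)) ∞ M := IsManifold.chart_mem_maximalAtlas p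
  have hp : p ∈ ψ.source := mem_chart_source _ p
  obtain ⟨ρ, hρ, hball⟩ := Metric.isOpen_iff.1 ψ.open_target _ (ψ.map_source hp)
  obtain ⟨X, hX, hXξ⟩ := exists_chartComp_eq hψ hξ
  have hα := (contDiffOn_dualForm (gbar := gbar) hψ hξ).mono hball
  -- Poincaré lemma on a ball: the closed dual form of `ξ` is `dt`.
  obtain ⟨t, ht⟩ := (convex_ball (ψ p) ρ).exists_forall_hasFDerivAt_of_fderiv_symmetric
    Metric.isOpen_ball (hα.differentiableOn (by simp))
    fun y hy v w => fderiv_dualForm_comm hψ hξ hLC hpar (hball hy) v w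
  have ht_smooth : ContDiffOn ℝ ∞ t (Metric.ball (ψ p) ρ) := by
    rw [contDiffOn_infty_iff_fderiv_of_isOpen Metric.isOpen_ball]
    exact ⟨fun y hy => (ht y hy).differentiableAt.differentiableWithinAt,
      hα.congr fun y hy => (ht y hy).fderiv⟩
  have hξp : chartComp ψ p (ξ p) = X (ψ p) := by
    have := hXξ _ (ψ.map_source hp)
    rwa [ψ.left_inv hp] at this
  -- The three side conditions are `ξ ≠ 0`, `dt ≠ 0` (nondegeneracy of `gbar`) and `dt(ξ) = gbar(ξ,
  -- ξ) = 0`.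
  obtain ⟨e, he, heU, hes, hes', heX, het, c, r, hbox⟩ := exists_straightening
    Metric.isOpen_ball (hX.mono hball) ht_smooth (Metric.mem_ball_self hρ)
    (by
      rw [← hξp]
      intro h0
      have h1 := coordField_chartComp hψ hp (ξ p)
      rw [h0] at h1
      exact (hnull p).1 (h1.symm.trans (map_zero _)))
    (by
      rw [(ht _ (Metric.mem_ball_self hρ)).fderiv]
      intro h0
      refine (hnull p).1 (gbar.eq_zero_of_forall fun w => ?_)
      rw [← dualForm_chartComp hψ hp w, h0]
      rfl)
    (by
      intro y hy
      rw [(ht y hy).fderiv, ← hXξ y (hball hy)]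
      have h1 := dualForm_chartComp (gbar := gbar) (ξ := ξ) hψ (ψ.map_target (hball hy))
        (ξ (ψ.symm y))
      rw [ψ.right_inv (hball hy)] at h1
      exact h1.trans (hnull _).2)
  have hsource : ∀ q ∈ (ψ.trans e).source, q ∈ ψ.source ∧ ψ q ∈ e.source := by
    intro q hq
    simpa only [mfld_simps] using hq
  have hdiff : ∀ y ∈ e.source, DifferentiableAt ℝ e y := fun y hy =>
    (hes.contDiffAt (e.open_source.mem_nhds hy)).differentiableAt (by simp)
  refine ⟨ψ.trans e, trans_mem_maximalAtlas hψ hes hes', by simpa only [mfld_simps] using ⟨hp, he⟩,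
    fun q hq => ?_, fun q hq v => ?_, c, r, ?_⟩
  · obtain ⟨h1, h2⟩ := hsource q hq
    rw [chartComp_trans hψ h1 (hdiff _ h2), ← heX _ h2, ← hXξ _ (ψ.map_source h1), ψ.left_inv h1]
  · obtain ⟨h1, h2⟩ := hsource q hq
    rw [chartComp_trans hψ h1 (hdiff _ h2), ← dualForm_chartComp hψ h1, ← (ht _ (heU h2)).fderiv]
    have h3 : (fun y => e y 1) =ᶠ[𝓝 (ψ q)] t :=
      Filter.eventually_of_mem (e.open_source.mem_nhds h2) het
    rw [← h3.fderiv_eq]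
    have h4 := (EuclideanSpace.proj (𝕜 := ℝ) (1 : Fin (d + 2))).hasFDerivAt.comp (ψ q)
      (hdiff _ h2).hasFDerivAt
    exact congrArg (fun l => l (chartComp ψ q v)) h4.fderiv.symm
  · rw [← hbox]
    ext y
    simp only [mfld_simps, Set.mem_inter_iff, Set.mem_preimage, and_iff_left_iff_imp]
    exact fun hy => hball (heU (e.map_target hy))

end Adapted

/-! ### Splitting off the coordinate `u` -/

section Points

variable {d : ℕ}

/-- The point with coordinates `(u, t, x)`. -/
noncomputable def joinPt (u : ℝ) (s : Screen d) : Coord d :=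
  WithLp.toLp 2 (Fin.cons u (Fin.cons s.1 s.2))

@[simp] theorem joinPt_zero (u : ℝ) (s : Screen d) : joinPt u s 0 = u := rfl

@[simp] theorem joinPt_one (u : ℝ) (s : Screen d) : joinPt u s 1 = s.1 := rfl

@[simp] theorem joinPt_succ_succ (u : ℝ) (s : Screen d) (i : Fin d) :
    joinPt u s i.succ.succ = s.2 i := rfl

@[simp] theorem screenPt_joinPt (u : ℝ) (s : Screen d) : screenPt (joinPt u s) = s := rfl

theorem coord_ext {a b : Coord d} (h0 : a 0 = b 0) (h : screenPt a = screenPt b) : a = b := by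
  ext i
  refine Fin.cases h0 (fun i => Fin.cases ?_ (fun i => ?_) i) i
  · exact congrArg Prod.fst h
  · exact congrFun (congrArg Prod.snd h) i

@[simp] theorem joinPt_screenPt (y : Coord d) : joinPt (y 0) (screenPt y) = y :=
  coord_ext rfl rfl

theorem contDiff_joinPt {E : Type*} [NormedAddCommGroup E] [NormedSpace ℝ E] {s : Set E}
    {u : E → ℝ} {f : E → Screen d} (hu : ContDiffOn ℝ ∞ u s) (hf : ContDiffOn ℝ ∞ f s) :
    ContDiffOn ℝ ∞ (fun x => joinPt (u x) (f x)) s := by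
  rw [contDiffOn_euclidean]
  intro i
  refine Fin.cases hu (fun i => Fin.cases ?_ (fun i => ?_) i) i
  · exact hf.fst
  · exact contDiffOn_pi.1 hf.snd i

/-- The projection `(u, t, x) ↦ (t, x)` as a linear map. -/
noncomputable def screenL (d : ℕ) : Coord d →L[ℝ] Screen d :=
  (EuclideanSpace.proj 1).prod (ContinuousLinearMap.pi fun i => EuclideanSpace.proj i.succ.succ)

theorem screenL_apply (y : Coord d) : screenL d y = screenPt y := rfl

theorem contDiff_screenPt : ContDiff ℝ ∞ (screenPt : Coord d → Screen d) := (screenL d).contDiff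

theorem isOpen_screenRegion {M : Type*} [TopologicalSpace M]
    (φ : OpenPartialHomeomorph M (Coord d)) : IsOpen (screenRegion φ) :=
  (screenL d).isOpenMap (fun s => ⟨joinPt 0 s, rfl⟩) _ φ.open_target

theorem screenPt_mem_screenRegion {M : Type*} [TopologicalSpace M]
    {φ : OpenPartialHomeomorph M (Coord d)} {p : M} (hp : p ∈ φ.source) :
    screenPt (φ p) ∈ screenRegion φ := ⟨_, φ.map_source hp, rfl⟩

/-- A function on a box whose derivative along the first coordinate vanishes does not depend on
that coordinate. -/
theorem eq_joinPt_of_fderiv_eq_zero {c : Coord d} {r : ℝ} {S : Set (Coord d)}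
    (hS : S = {y | ∀ i, |y i - c i| < r}) (hSo : IsOpen S) {F : Coord d → ℝ}
    (hF : ContDiffOn ℝ ∞ F S)
    (hF0 : ∀ y ∈ S, fderiv ℝ F y (EuclideanSpace.single 0 1) = 0) {y : Coord d} (hy : y ∈ S) :
    F y = F (joinPt (c 0) (screenPt y)) := by
  have hmem : joinPt (c 0) (screenPt y) ∈ S := by
    rw [hS] at hy ⊢
    refine fun i => Fin.cases ?_ (fun i => Fin.cases ?_ (fun i => ?_) i) i
    · simpa using (abs_nonneg _).trans_lt (hy 0)
    · exact hy 1
    · exact hy i.succ.succ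
  have hconv : Convex ℝ S := by
    have : S = (WithLp.ofLp : Coord d → Fin (d + 2) → ℝ) ⁻¹'
        Set.univ.pi (fun i => Metric.ball (c i) r) := by
      rw [hS]
      ext y
      simp [Real.dist_eq]
    rw [this]
    exact (convex_pi fun i _ => convex_ball (c i) r).linear_preimage
      (EuclideanSpace.equiv (Fin (d + 2)) ℝ).toLinearMap
  obtain ⟨z, hz, h⟩ := domain_mvt (f := F) (f' := fderiv ℝ F) (s := S) (fun x hx =>
    ((hF.contDiffAt (hSo.mem_nhds hx)).differentiableAt
      (by simp)).hasFDerivAt.hasFDerivWithinAt) hconv hmem hy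
  have h1 : y - joinPt (c 0) (screenPt y) = (y 0 - c 0) • EuclideanSpace.single 0 1 := by
    refine coord_ext (by simp) ?_
    refine Prod.ext ?_ (funext fun i => ?_) <;> simp [screenPt]
  rw [h1, map_smul, hF0 z (hconv.segment_subset hmem hy hz), smul_zero] at h
  exact sub_eq_zero.1 h

/-- The value of a bilinear form with `β e₀ b = b₁` in terms of its remaining components. -/
theorem bilin_eq_waveForm (β : Coord d →L[ℝ] Coord d →L[ℝ] ℝ) (hsymm : ∀ a b, β a b = β b a)
    (h0 : ∀ b, β (EuclideanSpace.single 0 1) b = b 1) (a : Coord d) :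
    β a a = waveForm (-(1 / 2) * β (EuclideanSpace.single 1 1) (EuclideanSpace.single 1 1))
      (fun i => β (EuclideanSpace.single 1 1) (EuclideanSpace.single i.succ.succ 1))
      (Matrix.of fun i j : Fin d => β (EuclideanSpace.single i.succ.succ 1)
        (EuclideanSpace.single j.succ.succ 1)) a := by
  set w : Coord d := ∑ i : Fin d, a i.succ.succ • EuclideanSpace.single i.succ.succ 1 with hw
  have ha : a = a 0 • EuclideanSpace.single 0 1 + (a 1 • EuclideanSpace.single 1 1 + w) := by
    have := (EuclideanSpace.basisFun (Fin (d + 2)) ℝ).sum_repr a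
    rw [Fin.sum_univ_succ, Fin.sum_univ_succ] at this
    simpa [hw] using this.symm
  have hw1 : w 1 = 0 := by simp [hw, Fin.ext_iff]
  have e1 : β (EuclideanSpace.single 1 1) w = ∑ i : Fin d, β (EuclideanSpace.single 1 1)
      (EuclideanSpace.single i.succ.succ 1) * a i.succ.succ := by
    rw [hw, map_sum]
    exact Finset.sum_congr rfl fun i _ => by rw [map_smul, smul_eq_mul, mul_comm]
  have e2 : β w w = ∑ i : Fin d, ∑ j : Fin d, β (EuclideanSpace.single i.succ.succ 1)
      (EuclideanSpace.single j.succ.succ 1) * a i.succ.succ * a j.succ.succ := by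
    conv_lhs => rw [hw]
    simp only [map_sum, map_smul, sum_apply, smul_apply, smul_eq_mul,
      Finset.mul_sum]
    rw [Finset.sum_comm]
    exact Finset.sum_congr rfl fun i _ => Finset.sum_congr rfl fun j _ => by ring
  have h01 : ∀ b, β b (EuclideanSpace.single 0 1) = b 1 := fun b => by rw [hsymm, h0]
  rw [waveForm]
  simp only [Matrix.of_apply]
  rw [← e1, ← e2]
  clear_value w
  generalize hb : a = b
  have ha' := ha
  conv_lhs => rw [← hb, ha]
  simp only [map_add, map_smul, add_apply, smul_apply, smul_eq_mul, h0, h01, hsymm w]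
  simp [hw1, ← hb]
  ring

end Points

/-! ### Existence of Brinkmann coordinates -/

section Brinkmann

variable {d : ℕ} {M : Type*} [TopologicalSpace M] [ChartedSpace (Coord d) M]
  [IsManifold (𝓡 (d + 2)) ∞ M] {φ : OpenPartialHomeomorph M (Coord d)}
  {g gbar : LorentzMetric d M} {ξ : VField d M} {Ω : M → ℝ}

/-- The metric at the point with coordinates `y`, as a bilinear form on components. -/
noncomputable def chartMetric (φ : OpenPartialHomeomorph M (Coord d)) (gbar : LorentzMetric d M)
    (y : Coord d) : Coord d →L[ℝ] Coord d →L[ℝ] ℝ :=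
  let L : Coord d →L[ℝ] Coord d := (mfderiv (𝓡 (d + 2)) 𝓘(ℝ, Coord d) φ (φ.symm y)).inverse
  let B : Coord d →L[ℝ] Coord d →L[ℝ] ℝ := gbar.val (φ.symm y)
  B.bilinearComp L L

theorem chartMetric_apply (y v w : Coord d) : chartMetric φ gbar y v w =
    inChart φ (fun q => gbar.val q (coordField φ v q) (coordField φ w q)) y := rfl

theorem chartMetric_symm (y v w : Coord d) :
    chartMetric φ gbar y v w = chartMetric φ gbar y w v := gbar.symm _ _ _

theorem chartMetric_chartComp (hφ : φ ∈ IsManifold.maximalAtlas (𝓡 (d + 2)) ∞ M) {p : M}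
    (hp : p ∈ φ.source) (v w : TangentSpace (𝓡 (d + 2)) p) :
    chartMetric φ gbar (φ p) (chartComp φ p v) (chartComp φ p w) = gbar.val p v w := by
  rw [chartMetric_apply, inChart, φ.left_inv hp, coordField_chartComp hφ hp,
    coordField_chartComp hφ hp]

theorem contDiffOn_chartMetric (hφ : φ ∈ IsManifold.maximalAtlas (𝓡 (d + 2)) ∞ M)
    (v w : Coord d) : ContDiffOn ℝ ∞ (fun y => chartMetric φ gbar y v w) φ.target :=
  contDiffOn_inChart hφ fun _ hp => (gbar.contMDiffAt_apply (contMDiffAt_coordField hφ hp v)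
    (contMDiffAt_coordField hφ hp w)).contMDiffWithinAt

theorem coordField_eq_of_chartComp (hφ : φ ∈ IsManifold.maximalAtlas (𝓡 (d + 2)) ∞ M)
    {v : Coord d} (hv : ∀ q ∈ φ.source, chartComp φ q (ξ q) = v) {p : M} (hp : p ∈ φ.source) :
    coordField φ v p = ξ p := by
  rw [← coordField_chartComp hφ hp (ξ p), hv p hp]

/-- The components of the metric are constant along a parallel coordinate vector field. -/
theorem fderiv_chartMetric_eq_zero (hφ : φ ∈ IsManifold.maximalAtlas (𝓡 (d + 2)) ∞ M)
    (hξ : IsSmoothField ξ) {nabla : AffineConnection d M} (hLC : IsLeviCivita gbar nabla)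
    (hpar : ∀ p, nabla ξ p = 0) {e : Coord d} (he : ∀ q ∈ φ.source, chartComp φ q (ξ q) = e)
    {y : Coord d} (hy : y ∈ φ.target) (v w : Coord d) :
    fderiv ℝ (fun y => chartMetric φ gbar y v w) y e = 0 := by
  obtain ⟨p, hp, rfl⟩ : ∃ p ∈ φ.source, φ p = y := ⟨_, φ.map_target hy, φ.right_inv hy⟩
  have hX := isDiffFieldAt_coordField hφ hp
  -- Near `p` the field `ξ` is itself a coordinate field, so its bracket with any other coordinate
  -- field vanishes.
  have h0 : ∀ v, nabla (coordField φ v) p (ξ p) = 0 := by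
    intro v
    rw [nabla_eq_mlieBracket hLC hξ hpar (hX v), ← mlieBracket_coordField hφ hp e v]
    exact Filter.EventuallyEq.mlieBracket_vectorField_eq
      (Filter.eventually_of_mem (φ.open_source.mem_nhds hp)
        fun q hq => (coordField_eq_of_chartComp hφ he hq).symm) Filter.EventuallyEq.rfl
  refine (fderiv_inChart hφ hp (gbar.mdifferentiableAt_apply (hX v) (hX w)) e).trans ?_
  rw [hLC.2 p _ _ (hX v) (hX w), coordField_eq_of_chartComp hφ he hp, h0, h0]
  simp

/-- The value of `h` on `x` is the square of the vector with components `(0, 0, x)`. This vector is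
orthogonal to the null field `∂_u`, having no `t`-component, and is not a multiple of it unless `x =
0`. -/
theorem posDef_chartMetric (hφ : φ ∈ IsManifold.maximalAtlas (𝓡 (d + 2)) ∞ M)
    (h0 : ∀ y ∈ φ.target, ∀ b, chartMetric φ gbar y (EuclideanSpace.single 0 1) b = b 1)
    {y : Coord d} (hy : y ∈ φ.target) :
    (Matrix.of fun i j : Fin d => chartMetric φ gbar y (EuclideanSpace.single i.succ.succ 1)
      (EuclideanSpace.single j.succ.succ 1)).PosDef := by
  refine Matrix.PosDef.of_dotProduct_mulVec_pos ?_ fun x hx => ?_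
  · ext i j
    exact chartMetric_symm _ _ _
  have hp := φ.map_target hy
  set p := φ.symm y
  have hval : ∀ v w, gbar.val p (coordField φ v p) (coordField φ w p) =
    chartMetric φ gbar y v w := fun v w => rfl
  have hcomp := chartComp_coordField hφ hp
  have h1 := bilin_eq_waveForm (chartMetric φ gbar y) (chartMetric_symm y) (h0 y hy)
    (joinPt 0 (0, x))
  have h2 : star x ⬝ᵥ ((Matrix.of fun i j : Fin d => chartMetric φ gbar y
      (EuclideanSpace.single i.succ.succ 1) (EuclideanSpace.single j.succ.succ 1)).mulVec x) =
      chartMetric φ gbar y (joinPt 0 (0, x)) (joinPt 0 (0, x)) := by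
    rw [h1]
    simp only [waveForm, dotProduct, Matrix.mulVec, Matrix.of_apply, joinPt_one,
      joinPt_succ_succ, Finset.mul_sum, Pi.star_apply, star_trivial]
    rw [mul_zero, zero_mul, zero_add]
    exact Finset.sum_congr rfl fun i _ => Finset.sum_congr rfl fun j _ => by ring
  rw [h2, ← hval]
  refine gbar.pos_of_orthogonal_null (ξ := coordField φ (EuclideanSpace.single 0 1) p) ?_ ?_ ?_ ?_
  · intro h
    have h3 := hcomp (EuclideanSpace.single 0 1)
    rw [h] at h3
    have h4 : (0 : Coord d) = EuclideanSpace.single 0 1 := (map_zero _).symm.trans h3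
    simpa using congrArg (fun a : Coord d => a 0) h4
  · rw [hval, h0 y hy]
    simp
  · rw [hval, h0 y hy]
    rfl
  · intro c h
    have h3 := hcomp (joinPt 0 (0, x))
    rw [h] at h3
    have h4 : c • (EuclideanSpace.single 0 1 : Coord d) = joinPt 0 (0, x) := by
      refine Eq.trans ?_ h3
      refine Eq.trans ?_ (map_smul (mfderiv (𝓡 (d + 2)) 𝓘(ℝ, Coord d) φ p) c _).symm
      exact congrArg (c • ·) (hcomp _).symm
    refine hx (funext fun i => ?_)
    have h5 := congrArg (fun a : Coord d => a i.succ.succ) h4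
    simpa using h5.symm

theorem IsPlatonicWave.exists_isBrinkmannChart (hP : IsPlatonicWave g ξ Ω) (p : M) :
    ∃ (φ : OpenPartialHomeomorph M (Coord d)) (conf U : Screen d → ℝ)
      (A : Screen d → Fin d → ℝ) (h : Screen d → Matrix (Fin d) (Fin d) ℝ),
      p ∈ φ.source ∧ IsBrinkmannChart g ξ Ω φ conf U A h := by
  obtain ⟨gbar, hc, nabla, hLC, hpar⟩ := hP.conformal
  have hnull : IsNullField gbar ξ := fun p => by
    have := (hP.null p).2
    rw [hc] at this
    exact ⟨(hP.null p).1, (mul_eq_zero.1 this).resolve_left (hP.factor_pos p).ne'⟩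
  obtain ⟨φ, hφ, hp, hφξ, hφt, c, r, hbox⟩ := exists_adapted_chart hP.smooth hnull hLC hpar p
  have h0 : ∀ y ∈ φ.target, ∀ b,
      chartMetric φ gbar y (EuclideanSpace.single 0 1) b = b 1 := by
    intro y hy b
    obtain ⟨q, hq, rfl⟩ : ∃ q ∈ φ.source, φ q = y := ⟨_, φ.map_target hy, φ.right_inv hy⟩
    have h1 := hφt q hq (coordField φ b q)
    rw [chartComp_coordField hφ hq, ← chartMetric_chartComp hφ hq, hφξ q hq,
      chartComp_coordField hφ hq] at h1
    exact h1.symm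
  have hΩ : ContDiffOn ℝ ∞ (inChart φ Ω) φ.target :=
    contDiffOn_inChart hφ hP.factor_smooth.contMDiffOn
  have hΩ0 : ∀ y ∈ φ.target, fderiv ℝ (inChart φ Ω) y (EuclideanSpace.single 0 1) = 0 := by
    intro y hy
    obtain ⟨q, hq, rfl⟩ : ∃ q ∈ φ.source, φ q = y := ⟨_, φ.map_target hy, φ.right_inv hy⟩
    rw [fderiv_inChart hφ hq (hP.factor_smooth.contMDiffAt.mdifferentiableAt (by simp)),
      coordField_eq_of_chartComp hφ hφξ hq]
    exact mvfderiv_factor_eq_zero hP.factor_smooth hc hLC hP.smooth hpar hP.killing q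
  -- Because the chart has a box as its range, each `(t, x)` may be completed by the central value
  -- `c 0` of `u`; all coefficients are defined by evaluation there.
  have hmem : ∀ s ∈ screenRegion φ, joinPt (c 0) s ∈ φ.target := by
    rintro s ⟨y, hy, rfl⟩
    rw [hbox] at hy ⊢
    refine fun i => Fin.cases ?_ (fun i => Fin.cases ?_ (fun i => ?_) i) i
    · simpa using (abs_nonneg _).trans_lt (hy 0)
    · exact hy 1
    · exact hy i.succ.succ
  have hjoin : ∀ {F : Coord d → ℝ}, ContDiffOn ℝ ∞ F φ.target →
      ContDiffOn ℝ ∞ (fun s => F (joinPt (c 0) s)) (screenRegion φ) := fun hF =>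
    hF.comp (contDiff_joinPt contDiffOn_const contDiffOn_id) hmem
  have hB : ∀ v w, ContDiffOn ℝ ∞ (fun s => chartMetric φ gbar (joinPt (c 0) s) v w)
      (screenRegion φ) := fun v w => hjoin (contDiffOn_chartMetric hφ v w)
  have hΩj : ∀ q ∈ φ.source, inChart φ Ω (joinPt (c 0) (screenPt (φ q))) = Ω q := fun q hq => by
    rw [← eq_joinPt_of_fderiv_eq_zero hbox φ.open_target hΩ hΩ0 (φ.map_source hq), inChart,
      φ.left_inv hq]
  have hBj : ∀ q ∈ φ.source, ∀ v w, chartMetric φ gbar (φ q) v w =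
      chartMetric φ gbar (joinPt (c 0) (screenPt (φ q))) v w := fun q hq v w =>
    eq_joinPt_of_fderiv_eq_zero hbox φ.open_target (contDiffOn_chartMetric hφ v w)
      (fun y hy => fderiv_chartMetric_eq_zero hφ hP.smooth hLC hpar hφξ hy v w)
      (φ.map_source hq)
  have hposDef := fun s hs => posDef_chartMetric hφ h0 (hmem s hs)
  have hline : ∀ q ∈ φ.source, ∀ v, g.val q v v = inChart φ Ω (joinPt (c 0) (screenPt (φ q))) *
      chartMetric φ gbar (joinPt (c 0) (screenPt (φ q))) (chartComp φ q v) (chartComp φ q v) :=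
    fun q hq v => by
      rw [hc, ← chartMetric_chartComp hφ hq, hΩj q hq, hBj q hq]
  have hsymm := chartMetric_symm (φ := φ) (gbar := gbar)
  generalize chartMetric φ gbar = β at *
  exact ⟨φ, fun s => inChart φ Ω (joinPt (c 0) s),
    -- The coefficient of `dt²` in `waveForm` is `-2 U`.
    fun s => -(1 / 2) * β (joinPt (c 0) s) (EuclideanSpace.single 1 1) (EuclideanSpace.single 1 1),
    fun s i => β (joinPt (c 0) s) (EuclideanSpace.single 1 1)
      (EuclideanSpace.single i.succ.succ 1),
    fun s => Matrix.of fun i j : Fin d => β (joinPt (c 0) s) (EuclideanSpace.single i.succ.succ 1)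
        (EuclideanSpace.single j.succ.succ 1), hp,
    { chart := hφ
      coord_field := hφξ
      factor := fun q hq => (hΩj q hq).symm
      smooth_factor := hjoin hΩ
      smooth_pot := contDiffOn_const.mul (hB _ _)
      smooth_coriolis := fun i => hB _ _
      smooth_space := fun i j => hB _ _
      posDef := hposDef
      line_element := fun q hq v => by
        rw [hline q hq v, bilin_eq_waveForm _ (hsymm _) (h0 _ (hmem _ (screenPt_mem_screenRegion hq)))] }⟩

end Brinkmann

/-! ### Rescaling of `u` and the degenerate Kundt form -/

section Rescaling

variable {d : ℕ}

/-- The change of coordinates `u ↦ f(t, x) u`. -/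
theorem exists_rescaling {T : Set (Coord d)} (hT : IsOpen T) {R : Set (Screen d)} (hR : IsOpen R)
    (hTR : ∀ y ∈ T, screenPt y ∈ R) {f : Screen d → ℝ} (hf : ContDiffOn ℝ ∞ f R)
    (hf0 : ∀ s ∈ R, f s ≠ 0) :
    ∃ e : OpenPartialHomeomorph (Coord d) (Coord d), e.source = T ∧
      (∀ y, e y = joinPt (f (screenPt y) * y 0) (screenPt y)) ∧
      ContDiffOn ℝ ∞ e e.source ∧ ContDiffOn ℝ ∞ e.symm e.target := by
  have hu : ContDiff ℝ ∞ (fun y : Coord d => y 0) :=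
    (EuclideanSpace.proj (𝕜 := ℝ) (0 : Fin (d + 2))).contDiff
  have hfR : ContDiffOn ℝ ∞ (fun y : Coord d => f (screenPt y)) (screenPt ⁻¹' R) :=
    hf.comp contDiff_screenPt.contDiffOn fun y hy => hy
  have hfwd : ContDiffOn ℝ ∞ (fun y : Coord d => joinPt (f (screenPt y) * y 0) (screenPt y)) T :=
    (contDiff_joinPt (hfR.mul hu.contDiffOn) contDiff_screenPt.contDiffOn).mono hTR
  have hbwd : ContDiffOn ℝ ∞ (fun y : Coord d => joinPt (y 0 / f (screenPt y)) (screenPt y))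
      (screenPt ⁻¹' R) :=
    contDiff_joinPt (hu.contDiffOn.div hfR fun y hy => hf0 _ hy) contDiff_screenPt.contDiffOn
  have hopen := hbwd.continuousOn.isOpen_inter_preimage
    (hR.preimage contDiff_screenPt.continuous) hT
  refine ⟨{ toFun := fun y => joinPt (f (screenPt y) * y 0) (screenPt y)
            invFun := fun y => joinPt (y 0 / f (screenPt y)) (screenPt y)
            source := T
            -- The inverse divides by `f`, which is known to be nonzero only over `R`.
            target := screenPt ⁻¹' R ∩ (fun y => joinPt (y 0 / f (screenPt y)) (screenPt y)) ⁻¹' T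
            map_source' := fun y hy => ?_
            map_target' := fun y hy => hy.2
            left_inv' := fun y hy => ?_
            right_inv' := fun y hy => ?_
            open_source := hT
            open_target := hopen
            continuousOn_toFun := hfwd.continuousOn
            continuousOn_invFun := hbwd.continuousOn.mono Set.inter_subset_left },
    rfl, fun y => rfl, hfwd, hbwd.mono Set.inter_subset_left⟩
  · have h := hf0 _ (hTR y hy)
    refine ⟨hTR y hy, ?_⟩
    simpa [mul_div_cancel_left₀ _ h] using hy
  · have h := hf0 _ (hTR y hy)
    simp [mul_div_cancel_left₀ _ h]
  · have h := hf0 _ hy.1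
    simp [mul_div_cancel₀ _ h]

theorem fderiv_rescaling {f : Screen d → ℝ} {y : Coord d}
    (hf : DifferentiableAt ℝ f (screenPt y)) {e : Coord d → Coord d}
    (he : DifferentiableAt ℝ e y) (hef : ∀ y, e y = joinPt (f (screenPt y) * y 0) (screenPt y))
    (a : Coord d) : fderiv ℝ e y a =
      joinPt (f (screenPt y) * a 0 + y 0 * fderiv ℝ f (screenPt y) (screenPt a)) (screenPt a) := by
  refine coord_ext ?_ ?_
  · have h1 := (EuclideanSpace.proj (𝕜 := ℝ) (0 : Fin (d + 2))).hasFDerivAt.comp y he.hasFDerivAt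
    have h2 := (hf.hasFDerivAt.comp y (screenL d).hasFDerivAt).mul
      (EuclideanSpace.proj (𝕜 := ℝ) (0 : Fin (d + 2))).hasFDerivAt
    have h3 := congrArg (fun l => l a) (h1.unique (h2.congr_of_eventuallyEq
      (Filter.Eventually.of_forall fun y => by simp [hef])))
    simpa [screenL_apply] using h3
  · have h1 := (screenL d).hasFDerivAt.comp y he.hasFDerivAt
    have h2 := (screenL d).hasFDerivAt (x := y)
    have h3 := congrArg (fun l => l a) (h1.unique (h2.congr_of_eventuallyEq
      (Filter.Eventually.of_forall fun y => by simp [hef, screenL_apply])))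
    simpa [screenL_apply] using h3

theorem fderiv_apply_eq_dT_add_dX (f : Screen d → ℝ) (s r : Screen d) :
    fderiv ℝ f s r = r.1 * dT f s + ∑ i, r.2 i * dX f i s := by
  have h1 : r = r.1 • ((1, 0) : Screen d) + ∑ i, r.2 i • ((0, Pi.single i 1) : Screen d) := by
    refine Prod.ext (by simp [Prod.fst_sum]) (funext fun j => ?_)
    simp [Prod.snd_sum, Finset.sum_apply, Pi.single_apply]
  conv_lhs => rw [h1]
  simp only [map_add, map_sum, map_smul, smul_eq_mul, dT, dX]

/-- With `c = Ω` and `dΩ = c (T dt + X_i dx^i)`, the new first component is `du' = Ω du + u dΩ`. The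
terms of the potentials linear in `u' = c u` cancel exactly `u dΩ`, leaving `c` times the old form.
-/
theorem waveForm_rescale (u c U T : ℝ) (A X : Fin d → ℝ) (h : Matrix (Fin d) (Fin d) ℝ)
    (a : Coord d) :
    waveForm ((c * u) ^ 2 * 0 + c * u * T + c * U) (fun i => c * u * -X i + c * A i) (c • h)
      (joinPt (c * a 0 + u * (c * (a 1 * T + ∑ i : Fin d, a i.succ.succ * X i))) (screenPt a)) =
      c * waveForm U A h a := by
  have h1 : ∑ i : Fin d, (c * u * -X i + c * A i) * a i.succ.succ =
      c * ∑ i : Fin d, A i * a i.succ.succ - c * u * ∑ i : Fin d, a i.succ.succ * X i := by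
    rw [Finset.mul_sum, Finset.mul_sum, ← Finset.sum_sub_distrib]
    exact Finset.sum_congr rfl fun i _ => by ring
  have h2 : ∑ i : Fin d, ∑ j : Fin d, c * h i j * a i.succ.succ * a j.succ.succ =
      c * ∑ i : Fin d, ∑ j : Fin d, h i j * a i.succ.succ * a j.succ.succ := by
    simp only [Finset.mul_sum, mul_assoc]
  simp only [waveForm, joinPt_zero, joinPt_one, joinPt_succ_succ, screenPt, Matrix.smul_apply,
    smul_eq_mul, h1, h2]
  ring

end Rescaling

section DegenerateKundt

variable {d : ℕ} {M : Type*} [TopologicalSpace M] [ChartedSpace (Coord d) M]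
  [IsManifold (𝓡 (d + 2)) ∞ M] {g : LorentzMetric d M} {ξ : VField d M} {Ω : M → ℝ}

theorem IsBrinkmannChart.exists_isDegenerateKundtChart (hΩ : ∀ p, 0 < Ω p)
    {φ : OpenPartialHomeomorph M (Coord d)} {conf U : Screen d → ℝ}
    {A : Screen d → Fin d → ℝ} {h : Screen d → Matrix (Fin d) (Fin d) ℝ}
    (hB : IsBrinkmannChart g ξ Ω φ conf U A h) :
    ∃ φ' : OpenPartialHomeomorph M (Coord d),
      φ'.source = φ.source ∧
      (∀ p ∈ φ.source, φ' p 0 = Ω p * φ p 0 ∧ screenPt (φ' p) = screenPt (φ p)) ∧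
      (∀ p ∈ φ.source, chartComp φ' p (ξ p) = EuclideanSpace.single 0 (Ω p)) ∧
      IsDegenerateKundtChart g φ'
        (fun _ ↦ 0)
        (fun s ↦ dT (fun r ↦ Real.log (conf r)) s)
        (fun s ↦ conf s * U s)
        (fun s i ↦ -dX (fun r ↦ Real.log (conf r)) i s)
        (fun s i ↦ conf s * A s i)
        (fun s ↦ conf s • h s) := by
  have hR := isOpen_screenRegion φ
  have hpos : ∀ s ∈ screenRegion φ, 0 < conf s := by
    rintro s ⟨y, hy, rfl⟩
    have h1 := hB.factor _ (φ.map_target hy)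
    rw [φ.right_inv hy] at h1
    exact h1 ▸ hΩ _
  have hmem : ∀ y ∈ φ.target, screenPt y ∈ screenRegion φ := fun y hy => ⟨y, hy, rfl⟩
  obtain ⟨e, hes, hef, he, he'⟩ := exists_rescaling φ.open_target hR hmem hB.smooth_factor
    fun s hs => (hpos s hs).ne'
  have hsource : (φ.trans e).source = φ.source := by
    ext p
    simp only [mfld_simps, Set.mem_inter_iff, Set.mem_preimage, hes, and_iff_left_iff_imp]
    exact φ.map_source
  have happ : ∀ p, (φ.trans e) p = joinPt (conf (screenPt (φ p)) * φ p 0) (screenPt (φ p)) :=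
    fun p => hef (φ p)
  have hregion : screenRegion (φ.trans e) = screenRegion φ := by
    rw [screenRegion, screenRegion, ← (φ.trans e).image_source_eq_target, hsource,
      ← φ.image_source_eq_target, Set.image_image, Set.image_image]
    simp only [happ, screenPt_joinPt]
  have hconf : ∀ s ∈ screenRegion φ, DifferentiableAt ℝ conf s := fun s hs =>
    (hB.smooth_factor.contDiffAt (hR.mem_nhds hs)).differentiableAt (by simp)
  have hcomp : ∀ p ∈ φ.source, ∀ v, chartComp (φ.trans e) p v =
      joinPt (conf (screenPt (φ p)) * chartComp φ p v 0 + φ p 0 *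
        fderiv ℝ conf (screenPt (φ p)) (screenPt (chartComp φ p v)))
        (screenPt (chartComp φ p v)) := by
    intro p hp v
    have hpe : φ p ∈ e.source := hes ▸ φ.map_source hp
    have hed : DifferentiableAt ℝ e (φ p) :=
      (he.contDiffAt (e.open_source.mem_nhds hpe)).differentiableAt (by simp)
    rw [chartComp_trans hB.chart hp hed,
      fderiv_rescaling (hconf _ (screenPt_mem_screenRegion hp)) hed hef]
  have hlog : ContDiffOn ℝ ∞ (fun r ↦ Real.log (conf r)) (screenRegion φ) :=
    hB.smooth_factor.log fun s hs => (hpos s hs).ne'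
  have hdlog : ∀ r, ContDiffOn ℝ ∞ (fun s => fderiv ℝ (fun r ↦ Real.log (conf r)) s r)
      (screenRegion φ) := fun r =>
    (hlog.fderiv_of_isOpen hR (m := ∞) (by simp)).clm_apply contDiffOn_const
  have hU1 : ContDiffOn ℝ ∞ (fun s ↦ dT (fun r ↦ Real.log (conf r)) s) (screenRegion φ) :=
    hdlog _
  have hU0 : ContDiffOn ℝ ∞ (fun s ↦ conf s * U s) (screenRegion φ) :=
    hB.smooth_factor.mul hB.smooth_pot
  have hA1 : ∀ i, ContDiffOn ℝ ∞ (fun s ↦ -dX (fun r ↦ Real.log (conf r)) i s)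
      (screenRegion φ) := fun i => (hdlog _).neg
  have hA0 : ∀ i, ContDiffOn ℝ ∞ (fun s ↦ conf s * A s i) (screenRegion φ) := fun i =>
    hB.smooth_factor.mul (hB.smooth_coriolis i)
  have hpull : ∀ {f : Screen d → ℝ}, ContDiffOn ℝ ∞ f (screenRegion φ) →
      ContDiffOn ℝ ∞ (fun y => f (screenPt y)) (φ.trans e).target := fun hf =>
    hf.comp contDiff_screenPt.contDiffOn fun y hy => hregion ▸ ⟨y, hy, rfl⟩
  have hu : ContDiffOn ℝ ∞ (fun y : Coord d => y 0) (φ.trans e).target :=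
    (EuclideanSpace.proj (𝕜 := ℝ) (0 : Fin (d + 2))).contDiff.contDiffOn
  refine ⟨φ.trans e, hsource, fun p hp => ?_, fun p hp => ?_,
    { kundt :=
        { chart := trans_mem_maximalAtlas hB.chart he he'
          smooth_pot := (((hu.pow 2).mul contDiffOn_const).add (hu.mul (hpull hU1))).add (hpull hU0)
          smooth_coriolis := fun i => (hu.mul (hpull (hA1 i))).add (hpull (hA0 i))
          smooth_space := fun i j => ?_
          posDef := fun s hs => ?_
          line_element := fun p hp v => ?_ }
      smooth_U2 := contDiffOn_const
      smooth_U1 := hregion ▸ hU1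
      smooth_U0 := hregion ▸ hU0
      smooth_A1 := fun i => hregion ▸ hA1 i
      smooth_A0 := fun i => hregion ▸ hA0 i }⟩
  · rw [happ, hB.factor p hp]
    exact ⟨rfl, rfl⟩
  · rw [hcomp p hp, hB.coord_field p hp, ← hB.factor p hp]
    -- `∂_u` has no `(t, x)` components, so the derivative of `conf` does not contribute and only
    -- the factor `Ω` remains.
    have h0 : screenPt (EuclideanSpace.single 0 1 : Coord d) = 0 :=
      Prod.ext (by simp [screenPt]) (funext fun i => by simp [screenPt])
    refine coord_ext ?_ ?_
    · simp [h0]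
    · rw [screenPt_joinPt, h0]
      exact Prod.ext (by simp [screenPt]) (funext fun i => by simp [screenPt])
  · rw [hregion]
    exact hB.smooth_factor.mul (hB.smooth_space i j)
  · rw [hregion] at hs
    exact (hB.posDef s hs).smul (hpos s hs)
  · rw [hsource] at hp
    have hs := screenPt_mem_screenRegion hp
    -- `dΩ = Ω d ln Ω` brings the components into the shape required by `waveForm_rescale`.
    have h1 : ∀ r, fderiv ℝ conf (screenPt (φ p)) r = conf (screenPt (φ p)) *
        fderiv ℝ (fun r ↦ Real.log (conf r)) (screenPt (φ p)) r := by
      intro r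
      rw [((hconf _ hs).hasFDerivAt.log (hpos _ hs).ne').fderiv]
      simp [mul_inv_cancel_left₀ (hpos _ hs).ne']
    rw [hB.line_element p hp, hcomp p hp, h1, fderiv_apply_eq_dT_add_dX, happ, screenPt_joinPt]
    exact (waveForm_rescale _ _ _ _ _ _ _ _).symm

end DegenerateKundt

theorem proposition4p22 {d : ℕ} {M : Type*} [TopologicalSpace M] [T2Space M]
    [SecondCountableTopology M] [ConnectedSpace M] [ChartedSpace (Coord d) M]
    [IsManifold (𝓡 (d + 2)) ∞ M]
    (g : LorentzMetric d M) (ξ : VField d M) (Ω : M → ℝ) (hP : IsPlatonicWave g ξ Ω) :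
    -- the null Killing vector field is geodesic, expansion-, shear- and twist-free
    IsKundtField g ξ ∧
    -- the wave is degenerate Kundt
    IsDegenerateKundtWave g ξ ∧
    -- Brinkmann coordinates exist around every point
    (∀ p : M, ∃ (φ : OpenPartialHomeomorph M (Coord d)) (conf U : Screen d → ℝ)
      (A : Screen d → Fin d → ℝ) (h : Screen d → Matrix (Fin d) (Fin d) ℝ),
      p ∈ φ.source ∧ IsBrinkmannChart g ξ Ω φ conf U A h) ∧
    -- in any of them, replacing `u` by `Ω u` yields the degenerate Kundt form
    (∀ (φ : OpenPartialHomeomorph M (Coord d)) (conf U : Screen d → ℝ)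
      (A : Screen d → Fin d → ℝ) (h : Screen d → Matrix (Fin d) (Fin d) ℝ),
      IsBrinkmannChart g ξ Ω φ conf U A h →
      ∃ φ' : OpenPartialHomeomorph M (Coord d),
        φ'.source = φ.source ∧
        (∀ p ∈ φ.source, φ' p 0 = Ω p * φ p 0 ∧ screenPt (φ' p) = screenPt (φ p)) ∧
        (∀ p ∈ φ.source, chartComp φ' p (ξ p) = EuclideanSpace.single 0 (Ω p)) ∧
        IsDegenerateKundtChart g φ'
          (fun _ ↦ 0)
          (fun s ↦ dT (fun r ↦ Real.log (conf r)) s)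
          (fun s ↦ conf s * U s)
          (fun s i ↦ -dX (fun r ↦ Real.log (conf r)) i s)
          (fun s i ↦ conf s * A s i)
          (fun s ↦ conf s • h s)) := by
  refine ⟨hP.isKundtField, ⟨hP.isKundtField, fun p => ?_⟩, hP.exists_isBrinkmannChart,
    fun φ conf U A h hB => hB.exists_isDegenerateKundtChart hP.factor_pos⟩
  obtain ⟨φ, conf, U, A, h, hp, hB⟩ := hP.exists_isBrinkmannChart p
  obtain ⟨φ', hsource, -, hξ, hK⟩ := hB.exists_isDegenerateKundtChart hP.factor_pos
  exact ⟨φ', _, _, _, _, _, _, hsource ▸ hp, hK, fun q hq => ⟨Ω q, hP.factor_pos q,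
    hξ q (hsource ▸ hq)⟩⟩
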